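/- Let $K$ be a field and let $A=\bigoplus_{i\in\mathbb Z}A_i$ be a finite-dimensional $\mathbb Z$-graded $K$-algebra with a triangular decomposition $(A^-,T,A^+)$, i.e. graded subalgebras of $A$ such that: (a) multiplication $A^-\otimes_K T\otimes_K A^+\to A$ is an isomorphism of vector spaces; (b) $T$ is concentrated in degree $0$, $A^+$ in degrees $\geq 0$ and $A^-$ in degrees $\leq 0$; (c) $A^-_0=K=A^+_0$; (d) $A^+T=TA^+$ and $A^-T=TA^-$; (e) $\operatorname{End}_T(M)=K$ for every simple $T$-module $M$. Let $\mathcal G(A)$ and $\mathcal G(T)$ be the categories of finitely generated $\mathbb Z$-graded left modules over $A$ and $T$, with degree-preserving morphisms. Let $\Lambda=\operatorname{Irr}\mathcal G(T)$ be the set of isomorphism classes of simple objects of $\mathcal G(T)$; each $\lambda\in\Lambda$ is concentrated in a single degree $\deg\lambda$, and $\Lambda$ is partially ordered by $\lambda<\mu\iff\deg\lambda<\deg\mu$. Let $B^+=A^+T$, let $J^+=\bigoplus_{i>0}B^+_i$, and for $\lambda\in\Lambda$ let $\Delta(\lambda)=A\otimes_{B^+}\lambda$ be the proper standard module, where $B^+$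 acts on $\lambda$ through $B^+\to B^+/J^+\cong T$, and let $L(\lambda)$ be the head of $\Delta(\lambda)$ in $\mathcal G(A)$. If $T$ is semisimple, then $\mathcal G(A)$ is a highest weight category in the sense of Cline–Parshall–Scott (in the formulation by projective and standard objects), with weight poset $\Lambda$, simple objects $L(\lambda)$ and standard objects $\Delta(\lambda)$. That is: 1. $\mathcal G(A)$ is a $K$-linear abelian category with finite-dimensional morphism spaces and enough projectives in which every object has finite length, and $\Lambda$ is interval-finite. 2. The $L(\lambda)$, $\lambda\in\Lambda$, form a complete and irredundant set of representatives of the isomorphism classes of simple objects of $\mathcal G(A)$, and $\operatorname{End}_{\mathcal G(A)}(L(\lambda))=K$. 3. For each $\lambda$ there is an epimorphism $\Delta(\lambda)\to L(\lambda)$ such that every composition factor $L(\mu)$ of its kernel satisfies $\mu<\lambda$. 4. Each $L(\lambda)$ has a projective cover $P(\lambda)$ in $\mathcal G(A)$, and there is an epimorphism $P(\lambda)\to\Delta(\lambda)$ whose kernel has a finite filtration with subquotients of the form $\Delta(\mu)$ with $\mu>\lambda$. -/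

import Mathlib

open CategoryTheory CategoryTheory.Limits
open scoped TensorProduct DirectSum

universe u v

noncomputable section

/-! ### Highest weight categories -/

namespace HWC

variable {C : Type*} [Category C] [hC : Preadditive C]

/-- `FilteredBy S X`: the object `X` has a finite filtration all of whose subquotients satisfy `S`
(`X` is obtained from a zero object by finitely many extensions by objects satisfying `S`). -/
inductive FilteredBy (S : C → Prop) : C → Prop
  | zero (X : C) (h : IsZero X) : FilteredBy S X
  | ext (X : ShortComplex C) (hX : X.ShortExact) (h₁ : FilteredBy S X.X₁) (h₃ : S X.X₃) :
      FilteredBy S X.X₂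

/-- `π : P ⟶ X` is a projective cover: `P` is projective and `π` is an essential epimorphism. -/
structure IsProjectiveCover {P X : C} (π : P ⟶ X) : Prop where
  projective : Projective P
  epi : Epi π
  essential : ∀ ⦃Q : C⦄ (g : Q ⟶ P), Epi (g ≫ π) → Epi g

/-- The `K`-linear category `C` is a highest weight category with weight poset `Λ`, simple objects
`L a` and standard objects `Δ a`. -/
structure IsHighestWeightCategory (K : Type*) [Field K] [Linear K C]
    {Λ : Type*} [PartialOrder Λ] (L Δ : Λ → C) : Prop where
  /-- `C` is an abelian category (for the given additive structure). -/
  abelian : ∃ h : Abelian C, h.toPreadditive = hC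
  /-- Every object has finite length. -/
  finite_length : ∀ X : C, IsArtinianObject X ∧ IsNoetherianObject X
  /-- Morphism spaces are finite-dimensional. -/
  hom_finite : ∀ X Y : C, Module.Finite K (X ⟶ Y)
  enough_projectives : EnoughProjectives C
  /-- The weight poset is interval-finite. -/
  interval_finite : ∀ a b : Λ, (Set.Icc a b).Finite
  /-- The `L a` form a complete and irredundant family of simple objects. -/
  simple : ∀ a, Simple (L a)
  complete : ∀ S : C, Simple S → ∃! a, Nonempty (S ≅ L a)
  /-- The simple objects are absolutely simple. -/
  simple_end : ∀ (a : Λ) (f : L a ⟶ L a), ∃ c : K, f = c • 𝟙 (L a)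
  /-- There is an epimorphism `Δ a ⟶ L a` such that all composition factors `L b` of its kernel
  satisfy `b < a`. -/
  standard : ∀ a, ∃ (R : C) (i : R ⟶ Δ a) (p : Δ a ⟶ L a) (w : i ≫ p = 0),
    (ShortComplex.mk i p w).ShortExact ∧
      FilteredBy (fun Y => ∃ b, b < a ∧ Nonempty (Y ≅ L b)) R
  /-- `L a` has a projective cover `P`, and there is an epimorphism `P ⟶ Δ a` whose kernel has a
  finite filtration with subquotients `Δ b` with `a < b`. -/
  projective_filtration : ∀ a, ∃ (P : C) (π : P ⟶ L a), IsProjectiveCover π ∧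
    ∃ (N : C) (i : N ⟶ P) (p : P ⟶ Δ a) (w : i ≫ p = 0),
      (ShortComplex.mk i p w).ShortExact ∧
        FilteredBy (fun Y => ∃ b, a < b ∧ Nonempty (Y ≅ Δ b)) N

/-- Isomorphism of simple objects. -/
def simpleSetoid (C : Type*) [Category C] [Preadditive C] : Setoid {X : C // Simple X} where
  r X Y := Nonempty (X.1 ≅ Y.1)
  iseqv := ⟨fun _ => ⟨Iso.refl _⟩, fun ⟨e⟩ => ⟨e.symm⟩, fun ⟨e⟩ ⟨f⟩ => ⟨e.trans f⟩⟩

/-- The isomorphism classes of simple objects. -/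
def Irr (C : Type*) [Category C] [Preadditive C] := Quotient (simpleSetoid C)

/-- A chosen representative of an isomorphism class of simple objects. -/
def Irr.rep {C : Type*} [Category C] [Preadditive C] (x : Irr C) : C := (Quotient.out x).1

end HWC

/-! ### Graded modules -/

namespace HWC

section Decomp

variable {K : Type v} [Field K] {V : Type u} [AddCommGroup V] [Module K V]

/-- The projection of a graded vector space onto a homogeneous component. -/
def projComp (𝒱 : ℤ → Submodule K V) [DirectSum.Decomposition 𝒱] (n : ℤ) : V →ₗ[K] V :=
  (𝒱 n).subtype ∘ₗ DirectSum.component K ℤ (fun i => 𝒱 i) n ∘ₗ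
    (DirectSum.decomposeLinearEquiv 𝒱).toLinearMap

lemma projComp_apply (𝒱 : ℤ → Submodule K V) [DirectSum.Decomposition 𝒱] (n : ℤ) (x : V) :
    projComp 𝒱 n x = (DirectSum.decompose 𝒱 x n : V) := rfl

lemma isInternal_of_proj (𝒱 : ℤ → Submodule K V) (p : ℤ → V →ₗ[K] V)
    (h₁ : ∀ i, ∀ x ∈ 𝒱 i, p i x = x) (h₂ : ∀ i j, i ≠ j → ∀ x ∈ 𝒱 j, p i x = 0)
    (htop : ⨆ i, 𝒱 i = ⊤) : DirectSum.IsInternal 𝒱 := by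
  refine DirectSum.isInternal_submodule_of_iSupIndep_of_iSup_eq_top ?_ htop
  intro i
  rw [Submodule.disjoint_def]
  intro x hx hx'
  have hle : (⨆ j, ⨆ (_ : j ≠ i), 𝒱 j) ≤ LinearMap.ker (p i) :=
    iSup₂_le fun j hj y hy => by
      rw [LinearMap.mem_ker]
      exact h₂ i j (Ne.symm hj) y hy
  rw [← h₁ i x hx]
  exact hle hx'

end Decomp

variable {K : Type v} [Field K] {A : Type u} [Ring A] [Algebra K A]

/-- Finitely generated `ℤ`-graded left modules over the graded `K`-algebra `A = ⨁ 𝒜 i`. -/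
structure GrMod (𝒜 : ℤ → Submodule K A) where
  carrier : Type u
  [addCommGroup : AddCommGroup carrier]
  [moduleK : Module K carrier]
  [moduleA : Module A carrier]
  [tower : IsScalarTower K A carrier]
  [finite : Module.Finite A carrier]
  /-- The homogeneous components. -/
  gr : ℤ → Submodule K carrier
  [decomp : DirectSum.Decomposition gr]
  smul_mem : ∀ {i j : ℤ} {a : A} {m : carrier}, a ∈ 𝒜 i → m ∈ gr j → a • m ∈ gr (i + j)

namespace GrMod

attribute [instance] addCommGroup moduleK moduleA tower finite decomp

variable {𝒜 : ℤ → Submodule K A}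

instance : CoeSort (GrMod 𝒜) (Type u) := ⟨carrier⟩

instance smulCommClass (M : GrMod 𝒜) : SMulCommClass A K M :=
  SMulCommClass.symm K A M

/-- The `K`-vector space of `A`-linear maps that preserve degrees. -/
def homSubmodule (M N : GrMod 𝒜) : Submodule K (M →ₗ[A] N) where
  carrier := {f | ∀ i, ∀ m ∈ M.gr i, f m ∈ N.gr i}
  add_mem' hf hg i m hm := (N.gr i).add_mem (hf i m hm) (hg i m hm)
  zero_mem' i _ _ := (N.gr i).zero_mem
  smul_mem' c _ hf i m hm := (N.gr i).smul_mem c (hf i m hm)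

/-- The category `𝒢(A)` of finitely generated graded modules with degree-preserving morphisms. -/
instance : Category.{u} (GrMod 𝒜) where
  Hom M N := homSubmodule M N
  id M := ⟨LinearMap.id, fun _ _ hm => hm⟩
  comp f g := ⟨g.1 ∘ₗ f.1, fun i m hm => g.2 i _ (f.2 i m hm)⟩

instance : Preadditive (GrMod 𝒜) where
  homGroup M N := inferInstanceAs (AddCommGroup (homSubmodule M N))
  add_comp _ _ _ f f' g := Subtype.ext (LinearMap.ext fun m => map_add g.1 (f.1 m) (f'.1 m))
  comp_add _ _ _ _ _ _ := Subtype.ext (LinearMap.ext fun _ => rfl)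

instance : Linear K (GrMod 𝒜) where
  homModule M N := inferInstanceAs (Module K (homSubmodule M N))
  smul_comp _ _ _ c f g := Subtype.ext (LinearMap.ext fun m =>
    (g.1.restrictScalars K).map_smul c (f.1 m))
  comp_smul _ _ _ _ _ _ := Subtype.ext (LinearMap.ext fun _ => rfl)

/-- The largest degree in the support of `M`; for a module concentrated in a single degree it is
that degree. -/
def degree (M : GrMod 𝒜) : ℤ := sSup {i | M.gr i ≠ ⊥}

lemma projComp_smul (M : GrMod 𝒜) {i : ℤ} {a : A} (ha : a ∈ 𝒜 i) (n : ℤ) (x : M) :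
    projComp M.gr n (a • x) = a • projComp M.gr (n - i) x := by
  induction x using DirectSum.Decomposition.inductionOn M.gr with
  | zero => simp
  | add x y hx hy => rw [smul_add, map_add, map_add, hx, hy, smul_add]
  | @homogeneous j m =>
    have h := M.smul_mem ha m.2
    simp only [projComp_apply]
    by_cases hn : i + j = n
    · subst hn
      rw [DirectSum.decompose_of_mem_same _ h, add_sub_cancel_left,
        DirectSum.decompose_of_mem_same _ m.2]
    · rw [DirectSum.decompose_of_mem_ne _ h hn,
        DirectSum.decompose_of_mem_ne _ m.2 (by omega), smul_zero]

lemma projComp_mem_of_mem_gr (M : GrMod 𝒜) (s : Submodule A M) {j : ℤ} {x : M} (hx : x ∈ M.gr j)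
    (hxs : x ∈ s) (n : ℤ) : projComp M.gr n x ∈ s := by
  rw [projComp_apply]
  by_cases h : j = n
  · subst h
    rwa [DirectSum.decompose_of_mem_same _ hx]
  · rw [DirectSum.decompose_of_mem_ne _ hx h]
    exact zero_mem _

lemma quotient_isInternal (M : GrMod 𝒜) (N : Submodule A M) (hN : N.IsHomogeneous M.gr) :
    DirectSum.IsInternal fun i => (M.gr i).map (N.mkQ.restrictScalars K) := by
  have hker (i : ℤ) : N.restrictScalars K ≤ (N.restrictScalars K).comap (projComp M.gr i) :=
    fun m hm => hN i hm
  refine isInternal_of_proj _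
    (fun i => ((N.restrictScalars K).mapQ (N.restrictScalars K) (projComp M.gr i) (hker i) :)) ?_
    ?_ ?_
  · rintro i _ ⟨m, hm, rfl⟩
    change N.mkQ (projComp M.gr i m) = N.mkQ m
    rw [projComp_apply, DirectSum.decompose_of_mem_same _ hm]
  · rintro i j hij _ ⟨m, hm, rfl⟩
    change N.mkQ (projComp M.gr i m) = 0
    rw [projComp_apply, DirectSum.decompose_of_mem_ne _ hm hij.symm, map_zero]
  · rw [← Submodule.map_iSup, (DirectSum.Decomposition.isInternal M.gr).submodule_iSup_eq_top,
      Submodule.map_top, LinearMap.range_eq_top]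
    exact N.mkQ_surjective

/-- The quotient of a graded module by a homogeneous submodule. -/
def quotient (M : GrMod 𝒜) (N : Submodule A M) (hN : N.IsHomogeneous M.gr) : GrMod 𝒜 where
  carrier := M ⧸ N
  gr i := (M.gr i).map (N.mkQ.restrictScalars K)
  decomp := (quotient_isInternal M N hN).chooseDecomposition
  smul_mem := by
    rintro i j a _ ha ⟨m, hm, rfl⟩
    exact ⟨a • m, M.smul_mem ha hm, rfl⟩

/-- `N` is a maximal proper graded submodule of `M`. -/
def IsMaximalGraded (M : GrMod 𝒜) (N : Submodule A M) : Prop :=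
  N.IsHomogeneous M.gr ∧ N ≠ ⊤ ∧
    ∀ N' : Submodule A M, N'.IsHomogeneous M.gr → N < N' → N' = ⊤

/-- The radical in the category of graded modules: the intersection of all maximal graded
submodules. -/
def radical (M : GrMod 𝒜) : Submodule A M := sInf {N | M.IsMaximalGraded N}

lemma radical_isHomogeneous (M : GrMod 𝒜) : M.radical.IsHomogeneous M.gr := by
  intro i m hm
  rw [radical, Submodule.mem_sInf] at hm ⊢
  exact fun N hN => hN.1 i (hm N hN)

/-- The head `M / Rad M`. -/
def head (M : GrMod 𝒜) : GrMod 𝒜 := M.quotient M.radical M.radical_isHomogeneous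

end GrMod

/-! ### The graded module `A ⊗[K] V` -/

section Tensor

variable (𝒜 : ℤ → Submodule K A) {V : Type u} [AddCommGroup V] [Module K V]
  (𝒱 : ℤ → Submodule K V)

/-- The grading of `A ⊗[K] V`: the degree `n` component is spanned by the `a ⊗ m` with `a` and `m`
homogeneous and `deg a + deg m = n`. -/
def tensorGr (n : ℤ) : Submodule K (A ⊗[K] V) :=
  Submodule.span K {x | ∃ i j, i + j = n ∧ ∃ a ∈ 𝒜 i, ∃ m ∈ 𝒱 j, a ⊗ₜ[K] m = x}

variable [GradedAlgebra 𝒜] [DirectSum.Decomposition 𝒱]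

/-- The projection onto the degree `n` component, as a bilinear map. -/
def tensorProjAux (n : ℤ) : A →ₗ[K] V →ₗ[K] A ⊗[K] V :=
  DirectSum.toModule K ℤ (V →ₗ[K] A ⊗[K] V)
    (fun i => (LinearMap.lcomp K (A ⊗[K] V) (projComp 𝒱 (n - i))) ∘ₗ TensorProduct.mk K A V ∘ₗ
      (𝒜 i).subtype) ∘ₗ (DirectSum.decomposeLinearEquiv 𝒜).toLinearMap

lemma tensorProjAux_apply (n : ℤ) {i : ℤ} {a : A} (ha : a ∈ 𝒜 i) (m : V) :
    tensorProjAux 𝒜 𝒱 n a m = a ⊗ₜ[K] projComp 𝒱 (n - i) m := by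
  simp only [tensorProjAux, LinearMap.comp_apply, LinearEquiv.coe_coe,
    DirectSum.decomposeLinearEquiv_apply, DirectSum.decompose_of_mem _ ha]
  erw [DirectSum.toModule_lof]
  rfl

lemma tensor_isInternal : DirectSum.IsInternal (tensorGr 𝒜 𝒱) := by
  refine isInternal_of_proj _ (fun n => TensorProduct.lift (tensorProjAux 𝒜 𝒱 n)) ?_ ?_ ?_
  · intro n x hx
    induction hx using Submodule.span_induction with
    | mem x hx =>
      obtain ⟨i, j, rfl, a, ha, m, hm, rfl⟩ := hx
      rw [TensorProduct.lift.tmul, tensorProjAux_apply 𝒜 𝒱 _ ha, projComp_apply,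
        add_sub_cancel_left, DirectSum.decompose_of_mem_same _ hm]
    | zero => simp
    | add x y _ _ hx hy => rw [map_add, hx, hy]
    | smul c x _ hx => rw [map_smul, hx]
  · intro n n' hn x hx
    induction hx using Submodule.span_induction with
    | mem x hx =>
      obtain ⟨i, j, rfl, a, ha, m, hm, rfl⟩ := hx
      rw [TensorProduct.lift.tmul, tensorProjAux_apply 𝒜 𝒱 _ ha, projComp_apply,
        DirectSum.decompose_of_mem_ne _ hm (by omega), TensorProduct.tmul_zero]
    | zero => simp
    | add x y _ _ hx hy => rw [map_add, hx, hy, add_zero]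
    | smul c x _ hx => rw [map_smul, hx, smul_zero]
  · rw [eq_top_iff]
    rintro x -
    induction x using TensorProduct.induction_on with
    | zero => exact zero_mem _
    | add x y hx hy => exact add_mem hx hy
    | tmul a m =>
      induction a using DirectSum.Decomposition.inductionOn 𝒜 with
      | zero => rw [TensorProduct.zero_tmul]; exact zero_mem _
      | add a a' h h' => rw [TensorProduct.add_tmul]; exact add_mem h h'
      | @homogeneous i a =>
        induction m using DirectSum.Decomposition.inductionOn 𝒱 with
        | zero => rw [TensorProduct.tmul_zero]; exact zero_mem _
        | add a a' h h' => rw [TensorProduct.tmul_add]; exact add_mem h h'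
        | @homogeneous j m =>
          exact Submodule.mem_iSup_of_mem (i + j)
            (Submodule.subset_span ⟨i, j, rfl, a, a.2, m, m.2, rfl⟩)

/-- `A ⊗[K] V` as a graded `A`-module, for a finite-dimensional graded vector space `V`. -/
def tensorGrMod [Module.Finite K V] : GrMod 𝒜 where
  carrier := A ⊗[K] V
  gr := tensorGr 𝒜 𝒱
  decomp := (tensor_isInternal 𝒜 𝒱).chooseDecomposition
  smul_mem := by
    intro i n a x ha hx
    induction hx using Submodule.span_induction with
    | mem x hx =>
      obtain ⟨j, k, rfl, b, hb, m, hm, rfl⟩ := hx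
      rw [TensorProduct.smul_tmul']
      exact Submodule.subset_span
        ⟨i + j, k, by omega, a * b, SetLike.mul_mem_graded ha hb, m, hm, rfl⟩
    | zero => rw [smul_zero]; exact zero_mem _
    | add x y _ _ hx hy => rw [smul_add]; exact add_mem hx hy
    | smul c x _ hx => rw [smul_comm]; exact Submodule.smul_mem _ c hx

lemma span_isHomogeneous (M : GrMod 𝒜) (s : Set M)
    (hs : ∀ x ∈ s, ∀ n, projComp M.gr n x ∈ Submodule.span A s) :
    (Submodule.span A s).IsHomogeneous M.gr := by
  intro n x hx
  rw [← projComp_apply]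
  induction hx using Submodule.span_induction generalizing n with
  | mem x hx => exact hs x hx n
  | zero => rw [map_zero]; exact zero_mem _
  | add x y _ _ hx hy => rw [map_add]; exact add_mem (hx n) (hy n)
  | smul a x _ hx =>
    induction a using DirectSum.Decomposition.inductionOn 𝒜 with
    | zero => rw [zero_smul, map_zero]; exact zero_mem _
    | add a b ha hb => rw [add_smul, map_add]; exact add_mem ha hb
    | @homogeneous i a =>
      rw [GrMod.projComp_smul M a.2]
      exact Submodule.smul_mem _ _ (hx _)

end Tensor

/-! ### Triangular decompositions -/

/-- The multiplication map `X ⊗ Y ⊗ Z → A` for subalgebras `X`, `Y`, `Z` of `A`. -/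
def mulMap₃ (X Y Z : Subalgebra K A) : (X ⊗[K] Y) ⊗[K] Z →ₗ[K] A :=
  LinearMap.mul' K A ∘ₗ TensorProduct.map
    (LinearMap.mul' K A ∘ₗ TensorProduct.map X.val.toLinearMap Y.val.toLinearMap)
    Z.val.toLinearMap

/-- A triangular decomposition `(A⁻, T, A⁺)` of a graded algebra `A = ⨁ 𝒜 i`. -/
structure TriangularDecomposition (𝒜 : ℤ → Submodule K A) [GradedAlgebra 𝒜] where
  neg : Subalgebra K A
  T : Subalgebra K A
  pos : Subalgebra K A
  /-- `A⁻`, `T` and `A⁺` are graded subalgebras. -/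
  neg_homogeneous : DirectSum.SetLike.IsHomogeneous 𝒜 neg
  T_homogeneous : DirectSum.SetLike.IsHomogeneous 𝒜 T
  pos_homogeneous : DirectSum.SetLike.IsHomogeneous 𝒜 pos
  /-- Multiplication `A⁻ ⊗ T ⊗ A⁺ → A` is an isomorphism of vector spaces. -/
  mul_bijective : Function.Bijective (mulMap₃ neg T pos)
  /-- `T` is concentrated in degree zero, `A⁺` in degrees `≥ 0`, and `A⁻` in degrees `≤ 0`. -/
  T_degree : ∀ t ∈ T, t ∈ 𝒜 0
  pos_degree : ∀ i, ∀ a ∈ pos, a ∈ 𝒜 i → a ≠ 0 → 0 ≤ i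
  neg_degree : ∀ i, ∀ a ∈ neg, a ∈ 𝒜 i → a ≠ 0 → i ≤ 0
  /-- The degree zero components of `A⁻` and `A⁺` are `K`. -/
  neg_zero : ∀ a ∈ neg, a ∈ 𝒜 0 → ∃ c : K, a = algebraMap K A c
  pos_zero : ∀ a ∈ pos, a ∈ 𝒜 0 → ∃ c : K, a = algebraMap K A c
  /-- `A⁺ T = T A⁺` and `A⁻ T = T A⁻` as subspaces of `A`. -/
  pos_mul_T : Subalgebra.toSubmodule pos * Subalgebra.toSubmodule T =
    Subalgebra.toSubmodule T * Subalgebra.toSubmodule pos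
  neg_mul_T : Subalgebra.toSubmodule neg * Subalgebra.toSubmodule T =
    Subalgebra.toSubmodule T * Subalgebra.toSubmodule neg
  /-- `T` is a split `K`-algebra: `End_T(M) = K` for every simple `T`-module `M`. -/
  T_split : ∀ (M : Type u) [AddCommGroup M] [Module K M] [Module T M] [IsScalarTower K T M],
    IsSimpleModule T M → ∀ f : M →ₗ[T] M, ∃ c : K, ∀ m, f m = c • m

namespace TriangularDecomposition

variable {𝒜 : ℤ → Submodule K A} [GradedAlgebra 𝒜] (𝒯 : TriangularDecomposition 𝒜)

/-- The induced grading of `T`. -/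
def gradT (i : ℤ) : Submodule K 𝒯.T := (𝒜 i).comap 𝒯.T.val.toLinearMap

/-- The positive Borel subalgebra `B⁺ = A⁺ T`. -/
def borel : Submodule K A := Subalgebra.toSubmodule 𝒯.pos * Subalgebra.toSubmodule 𝒯.T

/-- The relations defining `A ⊗_{B⁺} M` as a quotient of `A ⊗[K] M`, where `B⁺ = T ⊕ J⁺` acts on the
`T`-module `M` through the projection `B⁺ → T` with kernel `J⁺ = ⨁_{i > 0} B⁺ᵢ`. The `A`-submodule
generated by them is spanned by all `ab ⊗ m - a ⊗ bm` with `b ∈ B⁺`. -/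
def relations (M : GrMod 𝒯.gradT) : Set (A ⊗[K] M) :=
  {x | ∃ (t : 𝒯.T) (m : M), (t : A) ⊗ₜ[K] m - 1 ⊗ₜ[K] (t • m) = x} ∪
    {x | ∃ i, 0 < i ∧ ∃ b ∈ 𝒯.borel, b ∈ 𝒜 i ∧ ∃ m : M, b ⊗ₜ[K] m = x}

variable [FiniteDimensional K A]

instance (M : GrMod 𝒯.gradT) : Module.Finite K M := Module.Finite.trans 𝒯.T M

/-- The graded submodule of `A ⊗[K] M` generated by the relations. -/
def relationSubmodule (M : GrMod 𝒯.gradT) : Submodule A (tensorGrMod 𝒜 M.gr) :=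
  Submodule.span A (𝒯.relations M)

lemma relationSubmodule_isHomogeneous (M : GrMod 𝒯.gradT) :
    (𝒯.relationSubmodule M).IsHomogeneous (tensorGrMod 𝒜 M.gr).gr := by
  refine span_isHomogeneous 𝒜 (tensorGrMod 𝒜 M.gr) _ ?_
  have key (a : A) (j : ℤ) (ha : a ∈ 𝒜 j) (i : ℤ) (m : M) (hm : m ∈ M.gr i) :
      a ⊗ₜ[K] m ∈ tensorGr 𝒜 M.gr (j + i) :=
    Submodule.subset_span ⟨j, i, rfl, a, ha, m, hm, rfl⟩
  rintro x (⟨t, m, rfl⟩ | ⟨i, hi, b, hb, hbi, m, rfl⟩) n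
  · induction m using DirectSum.Decomposition.inductionOn M.gr with
    | zero => rw [smul_zero, TensorProduct.tmul_zero, TensorProduct.tmul_zero, sub_zero]
              erw [map_zero]; exact zero_mem _
    | add m m' h h' =>
      rw [smul_add, TensorProduct.tmul_add, TensorProduct.tmul_add, add_sub_add_comm]
      erw [map_add]
      exact add_mem h h'
    | @homogeneous j m =>
      refine GrMod.projComp_mem_of_mem_gr (tensorGrMod 𝒜 M.gr) _ (j := 0 + j) ?_
        (Submodule.subset_span (Or.inl ⟨t, m, rfl⟩)) n
      refine (tensorGr 𝒜 M.gr (0 + j)).sub_mem (key _ _ (𝒯.T_degree t t.2) _ _ m.2)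
        (key _ _ (SetLike.one_mem_graded 𝒜) _ _ ?_)
      have := M.smul_mem (i := 0) (j := j) (a := t) (𝒯.T_degree t t.2) m.2
      rwa [zero_add] at this
  · induction m using DirectSum.Decomposition.inductionOn M.gr with
    | zero => rw [TensorProduct.tmul_zero]; erw [map_zero]; exact zero_mem _
    | add m m' h h' =>
      rw [TensorProduct.tmul_add]
      erw [map_add]
      exact add_mem h h'
    | @homogeneous j m =>
      exact GrMod.projComp_mem_of_mem_gr (tensorGrMod 𝒜 M.gr) _ (key _ _ hbi _ _ m.2)
        (Submodule.subset_span (Or.inr ⟨i, hi, b, hb, hbi, m, rfl⟩)) n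

/-- The proper standard module `A ⊗_{B⁺} M` of a graded `T`-module `M`, where `deg (a ⊗ m) =
deg a + deg m`. -/
def properStandard (M : GrMod 𝒯.gradT) : GrMod 𝒜 :=
  (tensorGrMod 𝒜 M.gr).quotient (𝒯.relationSubmodule M) (𝒯.relationSubmodule_isHomogeneous M)

/-- The set `Irr 𝒢(T)` of isomorphism classes of simple graded `T`-modules. -/
def Weight := Irr (GrMod 𝒯.gradT)

variable {𝒯}

/-- The degree in which a simple graded `T`-module is concentrated. -/
def Weight.deg (w : 𝒯.Weight) : ℤ := (Irr.rep w).degree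

/-- The partial order on weights: `a < b` if and only if `deg a < deg b`. -/
instance : PartialOrder 𝒯.Weight where
  le a b := a = b ∨ a.deg < b.deg
  lt a b := a.deg < b.deg
  le_refl _ := Or.inl rfl
  le_trans a b c := by grind
  lt_iff_le_not_ge a b := by grind
  le_antisymm a b := by grind

variable (𝒯)

/-- The proper standard module `Δ(w)` of a weight `w`. -/
def Δ (w : 𝒯.Weight) : GrMod 𝒜 := 𝒯.properStandard (Irr.rep w)

/-- The module `L(w)`: the head of `Δ(w)`. -/
def L (w : 𝒯.Weight) : GrMod 𝒜 := (𝒯.Δ w).head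

end TriangularDecomposition

end HWC

end

/-! The argument is a dimension count that stands in for freeness over $A^-$. Put $n=\dim A^-$,
$B=A^+T$, let $J$ be the positive-degree part of $B$, and for a graded module $M$ put
$\operatorname{rad}M=A^-_{<0}M$. The triangular decomposition gives $A=A^-B$ together with $n\dim
B\le\dim A$. Since $A^-$ is $K$ plus negative degrees and gradings are bounded, Nakayama's lemma
holds for $\operatorname{rad}$ (`negS_smul_eq_top`), so $\dim M\le
n\cdot\dim(M/\operatorname{rad}M)$ for every $M$. Call $M$ tight if the reverse inequality holds as
well; this plays the role of being free over $A^-$.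

Semisimplicity of $T$ writes a weight $\lambda$ as $Te$ with $e\in T$ idempotent. Counting
dimensions in $Ae/AJe$ shows $\dim\Delta(\lambda)=n\dim\lambda$ (`le_finrank_Δ`), so $\lambda$
embeds as the top-degree component of $\Delta(\lambda)$. That component is simple over $T$ and
generates, hence $\Delta(\lambda)$ has a unique maximal graded submodule. A simple graded module is
recovered from its top component, which classifies the simples as the $L(\lambda)$. The kernel of
$\Delta(\lambda)\to L(\lambda)$ lives in degrees below $\deg\lambda$, and so do the top components
of its composition factors.

A tight module is filtered by proper standard modules (`filteredBy_Δ`): a simple $T$-submodule $\mu$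
of its top component yields $\Delta(\mu)\to M$, and equality throughout the count makes this map
injective with tight cokernel. The regular module is tight, tightness passes to direct summands
(`mul_headDim_le_of_retract`), and the projective cover $P(\lambda)$ is a summand of $Ae$. Finally
$P(\lambda)$ is generated by $e$ in degree $\deg\lambda$, so modulo $\operatorname{rad}$ and higher
degrees only one copy of $\lambda$ remains. It is used up by $\Delta(\lambda)$, the kernel of
$P(\lambda)\to\Delta(\lambda)$ is again tight, and it is generated over $A^-$ in degrees above
$\deg\lambda$ (`filteredBy_ker`). -/

noncomputable section

namespace HWC

/-! ### Homogeneous components of graded vector spaces -/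

section Decomp

variable {K : Type v} [Field K] {V : Type u} [AddCommGroup V] [Module K V]
  (𝒱 : ℤ → Submodule K V) [DirectSum.Decomposition 𝒱]

lemma projComp_mem (n : ℤ) (x : V) : projComp 𝒱 n x ∈ 𝒱 n :=
  (DirectSum.decompose 𝒱 x n).2

variable {𝒱}

lemma projComp_of_mem {n : ℤ} {x : V} (hx : x ∈ 𝒱 n) : projComp 𝒱 n x = x :=
  DirectSum.decompose_of_mem_same _ hx

lemma projComp_of_mem_ne {m n : ℤ} {x : V} (hx : x ∈ 𝒱 m) (h : m ≠ n) : projComp 𝒱 n x = 0 :=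
  DirectSum.decompose_of_mem_ne _ hx h

variable (𝒱)

lemma mem_iSup_projComp (x : V) (W : Submodule K V) (h : ∀ n, projComp 𝒱 n x ∈ W) : x ∈ W := by
  classical
  rw [← DirectSum.sum_support_decompose 𝒱 x]
  exact W.sum_mem fun i _ => h i

lemma eq_zero_of_projComp (x : V) (h : ∀ n, projComp 𝒱 n x = 0) : x = 0 :=
  mem_iSup_projComp 𝒱 x ⊥ h

variable {𝒱}

lemma mem_gr_of_projComp {n : ℤ} {x : V} (h : ∀ m, m ≠ n → projComp 𝒱 m x = 0) : x ∈ 𝒱 n := by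
  refine mem_iSup_projComp 𝒱 x _ fun m => ?_
  by_cases hm : m = n
  · subst hm; exact projComp_mem _ _ _
  · rw [h m hm]; exact zero_mem _

lemma eq_zero_of_mem_gr_of_mem_gr {m n : ℤ} {x : V} (hm : x ∈ 𝒱 m) (hn : x ∈ 𝒱 n) (h : m ≠ n) :
    x = 0 := by
  rw [← projComp_of_mem hn, projComp_of_mem_ne hm h]

lemma finite_gr_ne_bot [FiniteDimensional K V] : {i | 𝒱 i ≠ ⊥}.Finite :=
  WellFoundedGT.finite_ne_bot_of_iSupIndep
    (DirectSum.Decomposition.isInternal 𝒱).submodule_iSupIndep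

lemma exists_gr_ne_bot [Nontrivial V] : ∃ i, 𝒱 i ≠ ⊥ := by
  obtain ⟨x, hx⟩ := exists_ne (0 : V)
  by_contra! h
  exact hx (eq_zero_of_projComp 𝒱 x fun n => by simpa [h n] using projComp_mem 𝒱 n x)

lemma exists_top_gr [FiniteDimensional K V] [Nontrivial V] :
    ∃ d, 𝒱 d ≠ ⊥ ∧ ∀ i, d < i → 𝒱 i = ⊥ := by
  obtain ⟨d, hd, h⟩ := Set.exists_max_image _ id (finite_gr_ne_bot (𝒱 := 𝒱))
    (exists_gr_ne_bot (𝒱 := 𝒱))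
  refine ⟨d, hd, fun i hi => ?_⟩
  by_contra h'
  exact (h i h').not_gt hi

end Decomp

/-! ### The abelian category of graded modules -/

namespace GrMod

variable {K : Type v} [Field K] {A : Type u} [Ring A] [Algebra K A] {𝒜 : ℤ → Submodule K A}

section Hom

variable {M N P : GrMod 𝒜}

/-- The linear map underlying a morphism of graded modules. -/
def lin (f : M ⟶ N) : M →ₗ[A] N := f.1

/-- A degree-preserving linear map as a morphism. -/
def ofLin (f : M →ₗ[A] N) (hf : ∀ i, ∀ m ∈ M.gr i, f m ∈ N.gr i) : M ⟶ N := ⟨f, hf⟩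

@[simp] lemma lin_ofLin (f : M →ₗ[A] N) (hf) : lin (ofLin f hf) = f := rfl
@[simp] lemma lin_comp (f : M ⟶ N) (g : N ⟶ P) : lin (f ≫ g) = lin g ∘ₗ lin f := rfl
@[simp] lemma lin_zero : lin (0 : M ⟶ N) = 0 := rfl
@[simp] lemma lin_sub (f g : M ⟶ N) : lin (f - g) = lin f - lin g := rfl

lemma lin_mem (f : M ⟶ N) {i : ℤ} {m : M} (hm : m ∈ M.gr i) : lin f m ∈ N.gr i := f.2 i m hm

lemma hom_ext {f g : M ⟶ N} (h : ∀ x, lin f x = lin g x) : f = g :=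
  Subtype.ext (LinearMap.ext h)

lemma lin_projComp (f : M ⟶ N) (n : ℤ) (x : M) :
    lin f (projComp M.gr n x) = projComp N.gr n (lin f x) := by
  induction x using DirectSum.Decomposition.inductionOn M.gr with
  | zero => simp
  | add x y hx hy => simp only [map_add, hx, hy]
  | @homogeneous j m =>
    by_cases hj : j = n
    · subst hj
      rw [projComp_of_mem m.2, projComp_of_mem (lin_mem f m.2)]
    · rw [projComp_of_mem_ne m.2 hj, projComp_of_mem_ne (lin_mem f m.2) hj, map_zero]

lemma ker_isHomogeneous (f : M ⟶ N) : (LinearMap.ker (lin f)).IsHomogeneous M.gr := by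
  intro i m hm
  rw [LinearMap.mem_ker] at hm ⊢
  rw [← projComp_apply, lin_projComp, hm, map_zero]

lemma range_isHomogeneous (f : M ⟶ N) : (LinearMap.range (lin f)).IsHomogeneous N.gr := by
  rintro i _ ⟨m, rfl⟩
  exact ⟨projComp M.gr i m, lin_projComp f i m⟩

lemma comap_isHomogeneous (f : M ⟶ N) {N' : Submodule A N} (h : N'.IsHomogeneous N.gr) :
    (N'.comap (lin f)).IsHomogeneous M.gr := by
  intro i m hm
  rw [Submodule.mem_comap] at hm ⊢
  rw [← projComp_apply, lin_projComp]
  exact h i hm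

/-- Projecting an arbitrary preimage to degree `i` does not change its image, so lifts can be chosen
homogeneous. -/
lemma surjective_on_gr {f : M ⟶ N} (hf : Function.Surjective (lin f)) {i : ℤ} {y : N}
    (hy : y ∈ N.gr i) : ∃ x ∈ M.gr i, lin f x = y := by
  obtain ⟨x, rfl⟩ := hf y
  exact ⟨projComp M.gr i x, projComp_mem _ _ _, by rw [lin_projComp, projComp_of_mem hy]⟩

/-- A bijective morphism is an isomorphism. -/
def isoOfBijective (f : M ⟶ N) (hf : Function.Bijective (lin f)) : M ≅ N where
  hom := f
  inv := ofLin (LinearEquiv.ofBijective (lin f) hf).symm.toLinearMap fun i y hy => by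
    obtain ⟨x, hx, rfl⟩ := surjective_on_gr hf.2 hy
    have := LinearEquiv.ofBijective_symm_apply_apply (lin f) (h := hf) x
    simpa [this] using hx
  hom_inv_id := hom_ext fun x => LinearEquiv.ofBijective_symm_apply_apply (lin f) (h := hf) x
  inv_hom_id := hom_ext fun x => LinearEquiv.apply_ofBijective_symm_apply (lin f) (h := hf) x

lemma lin_inv_hom (e : M ≅ N) (x : N) : lin e.hom (lin e.inv x) = x :=
  LinearMap.congr_fun (congrArg lin e.inv_hom_id) x

lemma lin_hom_inv (e : M ≅ N) (x : M) : lin e.inv (lin e.hom x) = x :=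
  LinearMap.congr_fun (congrArg lin e.hom_inv_id) x

lemma bijective_of_isIso (f : M ⟶ N) [IsIso f] : Function.Bijective (lin f) :=
  ⟨Function.LeftInverse.injective (lin_hom_inv (asIso f)),
    Function.RightInverse.surjective (lin_inv_hom (asIso f))⟩

lemma isZero_iff : IsZero M ↔ Subsingleton M := by
  rw [IsZero.iff_id_eq_zero]
  refine ⟨fun h => ⟨fun x y => ?_⟩, fun h => hom_ext fun x => Subsingleton.elim _ _⟩
  have h' (x : M) : x = 0 := LinearMap.congr_fun (congrArg lin h) x
  rw [h' x, h' y]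

/-- The projection to the quotient by a homogeneous submodule. -/
def mkQ (M : GrMod 𝒜) (N : Submodule A M) (hN : N.IsHomogeneous M.gr) : M ⟶ M.quotient N hN :=
  ofLin (M := M) (N := M.quotient N hN) N.mkQ fun _ m hm => ⟨m, hm, rfl⟩

lemma mkQ_surjective (M : GrMod 𝒜) (N : Submodule A M) (hN : N.IsHomogeneous M.gr) :
    Function.Surjective (lin (M.mkQ N hN)) := N.mkQ_surjective

lemma ker_mkQ (M : GrMod 𝒜) (N : Submodule A M) (hN : N.IsHomogeneous M.gr) :
    LinearMap.ker (lin (M.mkQ N hN)) = N := N.ker_mkQ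

/-- A surjective morphism has the universal property of a quotient. -/
def descOfSurjective (g : M ⟶ N) (hg : Function.Surjective (lin g)) (k : M ⟶ P)
    (h : LinearMap.ker (lin g) ≤ LinearMap.ker (lin k)) : N ⟶ P :=
  ofLin ((LinearMap.ker (lin g)).liftQ (lin k) h ∘ₗ
      ((lin g).quotKerEquivOfSurjective hg).symm.toLinearMap) fun i y hy => by
    obtain ⟨x, hx, rfl⟩ := surjective_on_gr hg hy
    have : ((lin g).quotKerEquivOfSurjective hg).symm (lin g x) = Submodule.Quotient.mk x := by
      rw [LinearEquiv.symm_apply_eq]; rfl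
    simpa [this] using lin_mem k hx

lemma lin_descOfSurjective (g : M ⟶ N) (hg : Function.Surjective (lin g)) (k : M ⟶ P)
    (h : LinearMap.ker (lin g) ≤ LinearMap.ker (lin k)) (x : M) :
    lin (descOfSurjective g hg k h) (lin g x) = lin k x := by
  have : ((lin g).quotKerEquivOfSurjective hg).symm (lin g x) = Submodule.Quotient.mk x := by
    rw [LinearEquiv.symm_apply_eq]; rfl
  simp [descOfSurjective, this]

/-- An injective morphism has the universal property of a kernel. -/
def liftOfInjective (f : M ⟶ N) (hf : Function.Injective (lin f)) (k : P ⟶ N)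
    (h : LinearMap.range (lin k) ≤ LinearMap.range (lin f)) : P ⟶ M :=
  ofLin ((LinearEquiv.ofInjective (lin f) hf).symm.toLinearMap ∘ₗ
      (lin k).codRestrict (LinearMap.range (lin f)) fun x => h ⟨x, rfl⟩) fun i x hx => by
    set y := (LinearEquiv.ofInjective (lin f) hf).symm ⟨lin k x, h ⟨x, rfl⟩⟩ with hy
    have hfy : lin f y = lin k x := by
      rw [← LinearEquiv.ofInjective_apply (h := hf), hy, LinearEquiv.apply_symm_apply]
    change y ∈ M.gr i
    -- Degrees are reflected by an injective morphism: the other components of `y` are sent to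
    -- components of `lin k x`, which vanish.
    refine mem_gr_of_projComp fun m hm => hf ?_
    rw [lin_projComp, hfy, map_zero, projComp_of_mem_ne (lin_mem k hx) hm.symm]

lemma lin_liftOfInjective (f : M ⟶ N) (hf : Function.Injective (lin f)) (k : P ⟶ N)
    (h : LinearMap.range (lin k) ≤ LinearMap.range (lin f)) (x : P) :
    lin f (lin (liftOfInjective f hf k h) x) = lin k x := by
  rw [← LinearEquiv.ofInjective_apply (h := hf)]
  simp [liftOfInjective]

lemma epi_of_surjective (f : M ⟶ N) (hf : Function.Surjective (lin f)) : Epi f where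
  left_cancellation _ _ e := hom_ext fun y => by
    obtain ⟨x, rfl⟩ := hf y
    exact LinearMap.congr_fun (congrArg lin e) x

lemma mono_of_injective (f : M ⟶ N) (hf : Function.Injective (lin f)) : Mono f where
  right_cancellation _ _ e := hom_ext fun x => hf (LinearMap.congr_fun (congrArg lin e) x)

/-- The projection to the quotient by the range is a morphism of graded modules killing `f`, so it
is zero. -/
lemma surjective_of_epi (f : M ⟶ N) [Epi f] : Function.Surjective (lin f) := by
  have : f ≫ N.mkQ _ (range_isHomogeneous f) = 0 := hom_ext fun x =>
    (Submodule.Quotient.mk_eq_zero _).2 ⟨x, rfl⟩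
  have h0 := (cancel_epi f).1 (this.trans comp_zero.symm)
  rw [← LinearMap.range_eq_top, eq_top_iff]
  intro y _
  exact (Submodule.Quotient.mk_eq_zero _).1 (LinearMap.congr_fun (congrArg lin h0) y)

end Hom

lemma sub_isInternal (M : GrMod 𝒜) (N : Submodule A M) (hN : N.IsHomogeneous M.gr) :
    DirectSum.IsInternal fun i => (M.gr i).comap (N.subtype.restrictScalars K) := by
  refine isInternal_of_proj _ (fun i => (((projComp M.gr i) ∘ₗ
    (N.subtype.restrictScalars K)).codRestrict (N.restrictScalars K) fun x => hN i x.2 :)) ?_ ?_ ?_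
  · exact fun i x hx => Subtype.ext (projComp_of_mem hx)
  · exact fun i j hij x hx => Subtype.ext (projComp_of_mem_ne hx hij.symm)
  · classical
    rw [eq_top_iff]
    intro x _
    have hx : x = ∑ i ∈ (DirectSum.decompose M.gr (x : M)).support,
        (⟨projComp M.gr i x, hN i x.2⟩ : N) :=
      Subtype.ext (by
        rw [AddSubmonoidClass.coe_finsetSum]
        exact (DirectSum.sum_support_decompose M.gr (x : M)).symm)
    rw [hx]
    exact Submodule.sum_mem _ fun i _ => Submodule.mem_iSup_of_mem i (projComp_mem M.gr i _)

section FiniteDimensional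

variable [FiniteDimensional K A]

instance finiteK (M : GrMod 𝒜) : Module.Finite K M := Module.Finite.trans A M

instance noetherianA (M : GrMod 𝒜) : IsNoetherian A M := isNoetherian_of_tower K inferInstance

/-- A homogeneous submodule as a graded module. -/
def sub (M : GrMod 𝒜) (N : Submodule A M) (hN : N.IsHomogeneous M.gr) : GrMod 𝒜 where
  carrier := N
  gr i := (M.gr i).comap (N.subtype.restrictScalars K)
  decomp := (sub_isInternal M N hN).chooseDecomposition
  smul_mem ha hm := M.smul_mem ha hm

/-- The inclusion of a homogeneous submodule. -/
def incl (M : GrMod 𝒜) (N : Submodule A M) (hN : N.IsHomogeneous M.gr) : M.sub N hN ⟶ M :=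
  ofLin (M := M.sub N hN) (N := M) N.subtype fun _ _ hm => hm

lemma incl_injective (M : GrMod 𝒜) (N : Submodule A M) (hN : N.IsHomogeneous M.gr) :
    Function.Injective (lin (M.incl N hN)) := N.injective_subtype

lemma range_incl (M : GrMod 𝒜) (N : Submodule A M) (hN : N.IsHomogeneous M.gr) :
    LinearMap.range (lin (M.incl N hN)) = N := N.range_subtype

variable {M N P : GrMod 𝒜}

lemma injective_of_mono (f : M ⟶ N) [Mono f] : Function.Injective (lin f) := by
  have : M.incl _ (ker_isHomogeneous f) ≫ f = 0 := hom_ext fun x => x.2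
  have h0 := (cancel_mono f).1 (this.trans zero_comp.symm)
  rw [← LinearMap.ker_eq_bot, eq_bot_iff]
  intro y hy
  exact LinearMap.congr_fun (congrArg lin h0) (⟨y, hy⟩ : LinearMap.ker (lin f))

/-- An injective morphism is a kernel of any morphism whose kernel is its range. -/
def isLimitKernelFork (f : M ⟶ N) (g : N ⟶ P) (w : f ≫ g = 0) (hf : Function.Injective (lin f))
    (h : LinearMap.ker (lin g) ≤ LinearMap.range (lin f)) : IsLimit (KernelFork.ofι f w) :=
  have hr {W : GrMod 𝒜} (k : W ⟶ N) (hk : k ≫ g = 0) :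
      LinearMap.range (lin k) ≤ LinearMap.range (lin f) := by
    rintro _ ⟨x, rfl⟩
    exact h (LinearMap.congr_fun (congrArg lin hk) x)
  KernelFork.IsLimit.ofι _ _ (fun k hk => liftOfInjective f hf k (hr k hk))
    (fun k hk => hom_ext fun x => lin_liftOfInjective f hf k (hr k hk) x)
    (fun k hk m hm => hom_ext fun x => hf (by
      rw [lin_liftOfInjective]
      exact LinearMap.congr_fun (congrArg lin hm) x))

/-- A surjective morphism is a cokernel of any morphism whose range is its kernel. -/
def isColimitCokernelCofork (f : M ⟶ N) (g : N ⟶ P) (w : f ≫ g = 0)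
    (hg : Function.Surjective (lin g))
    (h : LinearMap.ker (lin g) ≤ LinearMap.range (lin f)) : IsColimit (CokernelCofork.ofπ g w) :=
  have hr {W : GrMod 𝒜} (k : N ⟶ W) (hk : f ≫ k = 0) :
      LinearMap.ker (lin g) ≤ LinearMap.ker (lin k) := by
    intro x hx
    obtain ⟨y, rfl⟩ := h hx
    exact LinearMap.congr_fun (congrArg lin hk) y
  CokernelCofork.IsColimit.ofπ _ _ (fun k hk => descOfSurjective g hg k (hr k hk))
    (fun k hk => hom_ext fun x => lin_descOfSurjective g hg k (hr k hk) x)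
    (fun k hk m hm => hom_ext fun y => by
      obtain ⟨x, rfl⟩ := hg y
      rw [lin_descOfSurjective]
      exact LinearMap.congr_fun (congrArg lin hm) x)

instance : HasKernels (GrMod 𝒜) where
  has_limit f := ⟨⟨_, isLimitKernelFork (incl _ _ (ker_isHomogeneous f)) f
    (hom_ext fun x => x.2) (incl_injective _ _ _) (range_incl _ _ _).ge⟩⟩

instance : HasCokernels (GrMod 𝒜) where
  has_colimit f := ⟨⟨_, isColimitCokernelCofork f (mkQ _ _ (range_isHomogeneous f))
    (hom_ext fun x => (Submodule.Quotient.mk_eq_zero _).2 ⟨x, rfl⟩)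
    (mkQ_surjective _ _ _) (ker_mkQ _ _ _).le⟩⟩

instance : IsNormalMonoCategory (GrMod 𝒜) where
  normalMonoOfMono f _ := ⟨{
    Z := _
    g := mkQ _ _ (range_isHomogeneous f)
    w := hom_ext fun x => (Submodule.Quotient.mk_eq_zero _).2 ⟨x, rfl⟩
    isLimit := isLimitKernelFork _ _ _ (injective_of_mono f) (ker_mkQ _ _ _).le }⟩

instance : IsNormalEpiCategory (GrMod 𝒜) where
  normalEpiOfEpi f _ := ⟨{
    W := _
    g := incl _ _ (ker_isHomogeneous f)
    w := hom_ext fun x => x.2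
    isColimit := isColimitCokernelCofork _ _ _ (surjective_of_epi f) (range_incl _ _ _).ge }⟩

end FiniteDimensional

lemma prod_isInternal (M N : GrMod 𝒜) :
    DirectSum.IsInternal fun i => (M.gr i).prod (N.gr i) := by
  refine isInternal_of_proj _ (fun i => (projComp M.gr i).prodMap (projComp N.gr i)) ?_ ?_ ?_
  · exact fun i x hx => Prod.ext (projComp_of_mem hx.1) (projComp_of_mem hx.2)
  · exact fun i j hij x hx => Prod.ext (projComp_of_mem_ne hx.1 hij.symm)
      (projComp_of_mem_ne hx.2 hij.symm)
  · rw [eq_top_iff]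
    rintro ⟨x, y⟩ _
    have h1 : (⊤ : Submodule K M) ≤
        (⨆ i, (M.gr i).prod (N.gr i)).comap (LinearMap.inl K M N) := by
      rw [← (DirectSum.Decomposition.isInternal M.gr).submodule_iSup_eq_top]
      exact iSup_le fun i m hm => Submodule.mem_iSup_of_mem i ⟨hm, zero_mem _⟩
    have h2 : (⊤ : Submodule K N) ≤
        (⨆ i, (M.gr i).prod (N.gr i)).comap (LinearMap.inr K M N) := by
      rw [← (DirectSum.Decomposition.isInternal N.gr).submodule_iSup_eq_top]
      exact iSup_le fun i m hm => Submodule.mem_iSup_of_mem i ⟨zero_mem _, hm⟩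
    have hx : (x, (0 : N)) ∈ ⨆ i, (M.gr i).prod (N.gr i) := h1 (Submodule.mem_top (R := K))
    have hy : ((0 : M), y) ∈ ⨆ i, (M.gr i).prod (N.gr i) := h2 (Submodule.mem_top (R := K))
    simpa using add_mem hx hy

/-- The product of two graded modules. -/
def prod (M N : GrMod 𝒜) : GrMod 𝒜 where
  carrier := M × N
  gr i := (M.gr i).prod (N.gr i)
  decomp := (prod_isInternal M N).chooseDecomposition
  smul_mem ha hm := ⟨M.smul_mem ha hm.1, N.smul_mem ha hm.2⟩

instance : HasBinaryBiproducts (GrMod 𝒜) where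
  has_binary_biproduct M N := HasBinaryBiproduct.mk
    { bicone :=
        { pt := M.prod N
          fst := ofLin (M := M.prod N) (N := M) (LinearMap.fst A M N) fun _ _ h => h.1
          snd := ofLin (M := M.prod N) (N := N) (LinearMap.snd A M N) fun _ _ h => h.2
          inl := ofLin (M := M) (N := M.prod N) (LinearMap.inl A M.carrier N.carrier)
            fun _ _ h => ⟨h, zero_mem _⟩
          inr := ofLin (M := N) (N := M.prod N) (LinearMap.inr A M.carrier N.carrier)
            fun _ _ h => ⟨zero_mem _, h⟩
          inl_fst := rfl
          inl_snd := rfl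
          inr_fst := rfl
          inr_snd := rfl }
      isBilimit := isBinaryBilimitOfTotal _ (hom_ext fun x => by
        change (((x : M × N).1, 0) + (0, (x : M × N).2) : M × N) = x
        rw [Prod.mk_add_mk, add_zero, zero_add]
        rfl) }

/-- The zero module. -/
def zeroMod (𝒜 : ℤ → Submodule K A) : GrMod 𝒜 where
  carrier := PUnit
  gr _ := ⊥
  decomp := (DirectSum.IsInternal.chooseDecomposition _ (isInternal_of_proj _ (fun _ => 0)
    (fun _ _ _ => Subsingleton.elim _ _) (fun _ _ _ _ _ => Subsingleton.elim _ _)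
    (Subsingleton.elim _ _)))
  smul_mem _ _ := Subsingleton.elim _ _

instance : HasZeroObject (GrMod 𝒜) :=
  ⟨⟨zeroMod 𝒜, isZero_iff.2 (inferInstanceAs (Subsingleton PUnit))⟩⟩

instance [FiniteDimensional K A] : Abelian (GrMod 𝒜) where
  has_finite_products := hasFiniteProducts_of_has_binary_and_terminal

section FiniteDimensional

variable [FiniteDimensional K A] {M N P : GrMod 𝒜}

lemma shortExact_mk (f : M ⟶ N) (g : N ⟶ P) (w : f ≫ g = 0) (hf : Function.Injective (lin f))
    (hg : Function.Surjective (lin g)) (h : LinearMap.ker (lin g) ≤ LinearMap.range (lin f)) :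
    (ShortComplex.mk f g w).ShortExact :=
  have := mono_of_injective f hf
  have := epi_of_surjective g hg
  ShortComplex.ShortExact.mk'
    (ShortComplex.exact_of_f_is_kernel _ (isLimitKernelFork f g w hf h)) ‹_› ‹_›

lemma ker_le_range_of_exact {X : ShortComplex (GrMod 𝒜)} (h : X.ShortExact) :
    LinearMap.ker (lin X.g) ≤ LinearMap.range (lin X.f) := by
  have := h.mono_f
  intro x hx
  have hw : incl _ _ (ker_isHomogeneous X.g) ≫ X.g = 0 := hom_ext fun x => x.2
  obtain ⟨l, hl⟩ := KernelFork.IsLimit.lift' h.fIsKernel _ hw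
  exact ⟨lin l (⟨x, hx⟩ : LinearMap.ker (lin X.g)),
    LinearMap.congr_fun (congrArg lin hl) (⟨x, hx⟩ : LinearMap.ker (lin X.g))⟩

lemma shortExact_incl (g : N ⟶ P) (hg : Function.Surjective (lin g)) :
    (ShortComplex.mk (N.incl _ (ker_isHomogeneous g)) g (hom_ext fun x => x.2)).ShortExact :=
  shortExact_mk _ _ _ (incl_injective _ _ _) hg (range_incl _ _ _).ge

/-- Transfers the chain conditions from the lattice of `A`-submodules to that of subobjects. -/
lemma strictMono_subobject (M : GrMod 𝒜) :
    StrictMono fun S : Subobject M => LinearMap.range (lin S.arrow) := by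
  intro S T hST
  have hf : Subobject.ofLE S T hST.le ≫ T.arrow = S.arrow := Subobject.ofLE_arrow _
  refine lt_of_le_of_ne ?_ fun heq => ?_
  · rintro _ ⟨x, rfl⟩
    exact ⟨lin (Subobject.ofLE S T hST.le) x, LinearMap.congr_fun (congrArg lin hf) x⟩
  · refine hST.not_ge (Subobject.le_of_comm
      (liftOfInjective S.arrow (injective_of_mono _) T.arrow (Eq.ge heq))
      (hom_ext fun x => lin_liftOfInjective _ _ _ _ x))

lemma finite_length (M : GrMod 𝒜) : IsArtinianObject M ∧ IsNoetherianObject M :=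
  have : IsArtinian A M := isArtinian_of_tower K inferInstance
  ⟨⟨(strictMono_subobject M).wellFoundedLT⟩, ⟨(strictMono_subobject M).wellFoundedGT⟩⟩

lemma hom_finite (M N : GrMod 𝒜) : Module.Finite K (M ⟶ N) := by
  let φ : (M ⟶ N) →ₗ[K] (M →ₗ[K] N) :=
    { toFun f := (lin f).restrictScalars K
      map_add' _ _ := rfl
      map_smul' _ _ := rfl }
  exact Module.Finite.of_injective φ fun f g h => hom_ext fun x => LinearMap.congr_fun h x

/-- Monomorphisms are, up to isomorphism, inclusions of homogeneous submodules, so categorical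
simplicity can be tested on these. -/
lemma simple_iff : Simple M ↔ Nontrivial M ∧
    ∀ N : Submodule A M, N.IsHomogeneous M.gr → N ≠ ⊥ → N = ⊤ := by
  constructor
  · intro h
    refine ⟨?_, fun N hN hne => ?_⟩
    · rw [← not_subsingleton_iff_nontrivial, ← isZero_iff]
      exact Simple.not_isZero M
    · have := mono_of_injective _ (incl_injective M N hN)
      have hi : IsIso (M.incl N hN) := by
        refine (Simple.mono_isIso_iff_nonzero _).2 fun h0 => hne ?_
        rw [← range_incl M N hN, h0, lin_zero, LinearMap.range_zero]
      rw [← range_incl M N hN, LinearMap.range_eq_top]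
      exact (bijective_of_isIso _).2
  · rintro ⟨hnt, h⟩
    refine ⟨fun {Y} f _ => ⟨fun hi h0 => ?_, fun h0 => ?_⟩⟩
    · obtain ⟨x, hx⟩ := exists_ne (0 : M)
      obtain ⟨y, rfl⟩ := (bijective_of_isIso f).2 x
      rw [h0] at hx
      exact hx rfl
    · have := h _ (range_isHomogeneous f) fun hb => h0 (hom_ext fun x =>
        LinearMap.congr_fun (LinearMap.range_eq_bot.1 hb) x)
      exact (isoOfBijective f ⟨injective_of_mono f, LinearMap.range_eq_top.1 this⟩).isIso_hom

end FiniteDimensional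

end GrMod

/-! ### Closure of filtrations under isomorphisms and extensions -/

lemma FilteredBy.of_iso {C : Type*} [Category C] [Preadditive C] {S : C → Prop} {X Y : C}
    (h : FilteredBy S X) (e : X ≅ Y) : FilteredBy S Y := by
  cases h with
  | zero _ h => exact .zero _ (h.of_iso e.symm)
  | ext X hX h₁ h₃ =>
    let X' := ShortComplex.mk (X.f ≫ e.hom) (e.inv ≫ X.g) (by simp)
    let i : X ≅ X' := ShortComplex.isoMk (Iso.refl X.X₁) e (Iso.refl X.X₃)
      (by simp [X']) (by simp [X'])
    exact .ext X' (ShortComplex.shortExact_of_iso i hX) h₁ h₃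

namespace GrMod

variable {K : Type v} [Field K] {A : Type u} [Ring A] [Algebra K A] {𝒜 : ℤ → Submodule K A}

/-- A filtration of the quotient is pulled back along `g` and continued by the one of `X`. In the
inductive step the preimage of the largest proper step of `Z` is an extension of that step by `X`.
-/
lemma filteredBy_of_exact [FiniteDimensional K A] {S : GrMod 𝒜 → Prop} {X Y Z : GrMod 𝒜}
    (f : X ⟶ Y) (g : Y ⟶ Z) (hf : Function.Injective (lin f))
    (hg : Function.Surjective (lin g)) (hfg : LinearMap.range (lin f) = LinearMap.ker (lin g))
    (hX : FilteredBy S X) (hZ : FilteredBy S Z) : FilteredBy S Y := by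
  induction hZ generalizing Y with
  | zero Z h =>
    have := isZero_iff.1 h
    refine hX.of_iso (isoOfBijective f ⟨hf, fun y => ?_⟩)
    have : y ∈ LinearMap.range (lin f) := hfg ▸ (Subsingleton.elim _ _ : lin g y = 0)
    exact this
  | ext Z hZ h₁ h₃ ih =>
    have hi : Function.Injective (lin Z.f) := have := hZ.mono_f; injective_of_mono Z.f
    have hs : Function.Surjective (lin Z.g) := have := hZ.epi_g; surjective_of_epi Z.g
    have hs' : Function.Surjective (lin (g ≫ Z.g)) := hs.comp hg
    have hw (x) : lin Z.g (lin Z.f x) = 0 := LinearMap.congr_fun (congrArg lin Z.zero) x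
    let ι := Y.incl _ (ker_isHomogeneous (g ≫ Z.g))
    have hι : LinearMap.range (lin ι) = LinearMap.ker (lin (g ≫ Z.g)) := range_incl _ _ _
    have hιi : Function.Injective (lin ι) := incl_injective _ _ _
    have hf' : LinearMap.range (lin f) ≤ LinearMap.range (lin ι) := by
      rw [hι, hfg]
      intro x hx
      rw [LinearMap.mem_ker] at hx
      simp [hx]
    have hg' : LinearMap.range (lin (ι ≫ g)) ≤ LinearMap.range (lin Z.f) := by
      rintro _ ⟨x, rfl⟩
      refine ker_le_range_of_exact hZ ?_
      have : lin ι x ∈ LinearMap.range (lin ι) := ⟨x, rfl⟩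
      rwa [hι] at this
    let f' := liftOfInjective ι hιi f hf'
    let g' := liftOfInjective Z.f hi (ι ≫ g) hg'
    have hf'e (x) : lin ι (lin f' x) = lin f x := lin_liftOfInjective ..
    have hg'e (x) : lin Z.f (lin g' x) = lin g (lin ι x) := lin_liftOfInjective ..
    refine .ext _ (shortExact_incl (g ≫ Z.g) hs') (ih f' g' ?_ ?_ ?_) h₃
    · intro x y hxy
      apply hf
      rw [← hf'e, ← hf'e, hxy]
    · intro z
      obtain ⟨y, hy⟩ := hg (lin Z.f z)
      have : y ∈ LinearMap.range (lin ι) := by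
        rw [hι]
        change lin Z.g (lin g y) = 0
        rw [hy, hw]
      obtain ⟨y, rfl⟩ := this
      exact ⟨y, hi (by rw [hg'e, hy])⟩
    · ext x
      rw [LinearMap.mem_ker, ← hi.eq_iff, hg'e, map_zero, ← LinearMap.mem_ker, ← hfg]
      constructor
      · rintro ⟨y, rfl⟩
        exact ⟨y, (hf'e y).symm⟩
      · rintro ⟨y, hy⟩
        exact ⟨y, hιi ((hf'e y).trans hy)⟩

/-! ### Projective graded modules and projective covers -/

section Tensor

variable {V : Type u} [AddCommGroup V] [Module K V]

/-- The `A`-linear map `A ⊗ V → M` induced by a `K`-linear map `V → M`. -/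
def tensorLift {M : GrMod 𝒜} (φ : V →ₗ[K] M) : A ⊗[K] V →ₗ[A] M :=
  TensorProduct.AlgebraTensorModule.lift (LinearMap.toSpanSingleton A (V →ₗ[K] M) φ)

@[simp] lemma tensorLift_tmul {M : GrMod 𝒜} (φ : V →ₗ[K] M) (a : A) (x : V) :
    tensorLift φ (a ⊗ₜ[K] x) = a • φ x := rfl

variable (𝒱 : ℤ → Submodule K V)

lemma tensorLift_mem {M : GrMod 𝒜} (φ : V →ₗ[K] M) (hφ : ∀ i, ∀ x ∈ 𝒱 i, φ x ∈ M.gr i)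
    (n : ℤ) (x : A ⊗[K] V) (hx : x ∈ tensorGr 𝒜 𝒱 n) : tensorLift φ x ∈ M.gr n := by
  induction hx using Submodule.span_induction with
  | mem x hx =>
    obtain ⟨i, j, rfl, a, ha, m, hm, rfl⟩ := hx
    exact M.smul_mem ha (hφ j m hm)
  | zero => rw [map_zero]; exact zero_mem _
  | add x y _ _ hx hy => rw [map_add]; exact add_mem hx hy
  | smul c x _ hx =>
    rw [← algebraMap_smul A c x, map_smul, algebraMap_smul]
    exact Submodule.smul_mem _ c hx

/-- Any linear section can be made degree-preserving by keeping, on each component, only the part of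
the same degree. -/
lemma exists_graded_section {M N : GrMod 𝒜} (g : M ⟶ N) (hg : Function.Surjective (lin g)) :
    ∃ s : N →ₗ[K] M, (∀ i, ∀ x ∈ N.gr i, s x ∈ M.gr i) ∧ ∀ x, lin g (s x) = x := by
  obtain ⟨s₀, hs₀⟩ := ((lin g).restrictScalars K).exists_rightInverse_of_surjective
    (LinearMap.range_eq_top.2 hg)
  have hs₀ (x) : lin g (s₀ x) = x := LinearMap.congr_fun hs₀ x
  let s : N →ₗ[K] M := DirectSum.toModule K ℤ M
    (fun i => projComp M.gr i ∘ₗ s₀ ∘ₗ (N.gr i).subtype) ∘ₗ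
      (DirectSum.decomposeLinearEquiv N.gr).toLinearMap
  have hs (i : ℤ) (x : N) (hx : x ∈ N.gr i) : s x = projComp M.gr i (s₀ x) := by
    simp only [s, LinearMap.comp_apply, LinearEquiv.coe_coe,
      DirectSum.decomposeLinearEquiv_apply, DirectSum.decompose_of_mem _ hx]
    erw [DirectSum.toModule_lof]
    rfl
  refine ⟨s, fun i x hx => hs i x hx ▸ projComp_mem _ _ _, fun x => ?_⟩
  induction x using DirectSum.Decomposition.inductionOn N.gr with
  | zero => simp
  | add x y hx hy => rw [map_add, map_add, hx, hy]
  | @homogeneous j m => rw [hs j m m.2, lin_projComp, hs₀, projComp_of_mem m.2]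

lemma tmul_mem_tensorGr {x : V} {i j : ℤ} {a : A} (ha : a ∈ 𝒜 i) (hx : x ∈ 𝒱 j) :
    a ⊗ₜ[K] x ∈ tensorGr 𝒜 𝒱 (i + j) :=
  Submodule.subset_span ⟨i, j, rfl, a, ha, x, hx, rfl⟩

variable [GradedAlgebra 𝒜] [DirectSum.Decomposition 𝒱] [Module.Finite K V]

/-- The morphism `A ⊗ V ⟶ M` induced by a degree-preserving linear map `V → M`. -/
def tensorHom {M : GrMod 𝒜} (φ : V →ₗ[K] M) (hφ : ∀ i, ∀ x ∈ 𝒱 i, φ x ∈ M.gr i) :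
    tensorGrMod 𝒜 𝒱 ⟶ M :=
  ofLin (M := tensorGrMod 𝒜 𝒱) (tensorLift φ) (tensorLift_mem 𝒱 φ hφ)

lemma projective_tensorGrMod : Projective (tensorGrMod 𝒜 𝒱) where
  factors {M N} f g _ := by
    obtain ⟨s, hs, hgs⟩ := exists_graded_section g (surjective_of_epi g)
    let F : A ⊗[K] V →ₗ[A] N := (lin f :)
    let φ : V →ₗ[K] N := F.restrictScalars K ∘ₗ TensorProduct.mk K A V 1
    have hφ (i : ℤ) (x : V) (hx : x ∈ 𝒱 i) : φ x ∈ N.gr i := by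
      have := tmul_mem_tensorGr 𝒱 (SetLike.one_mem_graded 𝒜) hx
      rw [zero_add] at this
      exact lin_mem f this
    have key (x : A ⊗[K] V) : lin g (tensorLift (s ∘ₗ φ) x) = F x := by
      induction x using TensorProduct.induction_on with
      | zero => rw [map_zero, map_zero, map_zero]
      | add x y hx hy => rw [map_add, map_add, map_add, hx, hy]
      | tmul a v =>
        rw [tensorLift_tmul, map_smul, LinearMap.comp_apply, hgs]
        change a • F (1 ⊗ₜ v) = _
        rw [← map_smul, TensorProduct.smul_tmul', smul_eq_mul, mul_one]
    exact ⟨tensorHom 𝒱 (s ∘ₗ φ) fun i x hx => hs i _ (hφ i x hx), hom_ext key⟩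

end Tensor

section Projective

variable [GradedAlgebra 𝒜] [FiniteDimensional K A]

instance : EnoughProjectives (GrMod 𝒜) where
  presentation M := ⟨{
    p := tensorGrMod 𝒜 M.gr
    projective := projective_tensorGrMod _
    f := tensorHom M.gr LinearMap.id fun _ _ hx => hx
    epi := epi_of_surjective _ fun x => ⟨(1 : A) ⊗ₜ[K] x, one_smul A x⟩ }⟩

omit [FiniteDimensional K A] in
lemma shift_isInternal (d : ℤ) : DirectSum.IsInternal fun i => 𝒜 (i - d) := by
  refine isInternal_of_proj _ (fun i => projComp 𝒜 (i - d)) ?_ ?_ ?_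
  · exact fun i x hx => projComp_of_mem hx
  · exact fun i j hij x hx => projComp_of_mem_ne hx (by omega)
  · rw [← (DirectSum.Decomposition.isInternal 𝒜).submodule_iSup_eq_top]
    exact (Equiv.subRight d).iSup_comp (g := 𝒜)

variable (𝒜) in
/-- The left regular module with its generator in degree `d`. -/
def regular (d : ℤ) : GrMod 𝒜 where
  carrier := A
  gr i := 𝒜 (i - d)
  decomp := (shift_isInternal d).chooseDecomposition
  smul_mem {i j a m} ha hm := by
    rw [add_sub_assoc]
    exact SetLike.mul_mem_graded ha hm

omit [FiniteDimensional K A] in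
lemma span_singleton_isHomogeneous (M : GrMod 𝒜) {i : ℤ} {x : M} (hx : x ∈ M.gr i) :
    (Submodule.span A {x}).IsHomogeneous M.gr := by
  refine span_isHomogeneous 𝒜 M _ ?_
  rintro _ rfl n
  exact M.projComp_mem_of_mem_gr _ hx (Submodule.mem_span_singleton_self _) n

/-- The left ideal `A e` with `e` placed in degree `d`. -/
def leftIdeal (d : ℤ) {e : A} (he : e ∈ 𝒜 0) : GrMod 𝒜 :=
  (regular 𝒜 d).sub (Submodule.span A {e})
    (span_singleton_isHomogeneous (regular 𝒜 d) (i := d) (by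
      change e ∈ 𝒜 (d - d)
      rwa [sub_self]))

/-- The generator of `A e`. -/
def leftIdealGen (d : ℤ) {e : A} (he : e ∈ 𝒜 0) : leftIdeal d he :=
  (⟨e, Submodule.mem_span_singleton_self e⟩ : Submodule.span A {e})

lemma leftIdealGen_mem (d : ℤ) {e : A} (he : e ∈ 𝒜 0) :
    leftIdealGen d he ∈ (leftIdeal d he).gr d := by
  change e ∈ 𝒜 (d - d)
  rwa [sub_self]

/-- A morphism out of $Ae$ is determined by the image of $e$. If $m$ is a homogeneous lift of that
image, $x\mapsto xm$ is a lift of the morphism because $x=xe$ on $Ae$; no normalisation $em=m$ is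
needed. -/
lemma projective_leftIdeal (d : ℤ) {e : A} (he : e ∈ 𝒜 0) (hee : e * e = e) :
    Projective (leftIdeal d he) where
  factors {M N} f g _ := by
    obtain ⟨m, hm, hgm⟩ := surjective_on_gr (surjective_of_epi g)
      (lin_mem f (leftIdealGen_mem d he))
    refine ⟨ofLin (M := leftIdeal d he)
      (LinearMap.toSpanSingleton A M m ∘ₗ (Submodule.span A {e}).subtype)
        fun i (x : Submodule.span A {e}) hx => ?_,
      hom_ext fun (x : Submodule.span A {e}) => ?_⟩
    · have := M.smul_mem (i := i - d) (j := d) (a := x) hx hm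
      rwa [sub_add_cancel] at this
    · change lin g ((x : A) • m : M) = _
      rw [map_smul, hgm, ← map_smul]
      congr 1
      obtain ⟨a, ha⟩ := Submodule.mem_span_singleton.1 x.2
      refine Subtype.ext ?_
      change (x : A) * e = (x : A)
      rw [← ha, smul_eq_mul, mul_assoc, hee]

omit [GradedAlgebra 𝒜] in
-- Among the retracts of `Q` that map onto `X`, one of least dimension is a projective cover. If `g
-- ≫ π` is epi, lifting `π` through it gives an endomorphism of `P` over `X` that factors through
-- `g`. By Fitting's lemma the range of a high power is a retract of `P`, still mapping onto `X`, so
-- minimality makes it all of `P`.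
lemma exists_projectiveCover {Q X : GrMod 𝒜} [Projective Q] (q : Q ⟶ X) [Epi q] :
    ∃ (P : GrMod 𝒜) (π : P ⟶ X), IsProjectiveCover π ∧ Nonempty (Retract P Q) := by
  classical
  have hex : ∃ n, ∃ (P : GrMod 𝒜) (π : P ⟶ X), Epi π ∧ Nonempty (Retract P Q) ∧
      Module.finrank K P = n := ⟨_, Q, q, inferInstance, ⟨Retract.refl Q⟩, rfl⟩
  obtain ⟨P, π, hπ, ⟨r⟩, hP⟩ := Nat.find_spec hex
  have hmin (R : GrMod 𝒜) (ρ : R ⟶ X) (h : Epi ρ) (hR : Nonempty (Retract R Q)) :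
      Module.finrank K P ≤ Module.finrank K R :=
    hP.trans_le (Nat.find_min' hex ⟨R, ρ, h, hR, rfl⟩)
  have : Projective P := r.projective
  refine ⟨P, π, ⟨this, hπ, fun Y g hg => ?_⟩, ⟨r⟩⟩
  let s := Projective.factorThru π (g ≫ π)
  have hs : s ≫ g ≫ π = π := Projective.factorThru_comp π (g ≫ π)
  have : IsArtinian A P := isArtinian_of_tower K inferInstance
  let φ : Module.End A P := lin (s ≫ g)
  obtain ⟨n, hn⟩ := Filter.eventually_atTop.1 φ.eventually_isCompl_ker_pow_range_pow
  have hpow (m : ℕ) : ∃ ψ : P ⟶ P, lin ψ = φ ^ m ∧ ψ ≫ π = π := by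
    induction m with
    | zero => exact ⟨𝟙 P, rfl, by simp⟩
    | succ m ih =>
      obtain ⟨ψ, h1, h2⟩ := ih
      refine ⟨ψ ≫ s ≫ g, ?_, by simp [hs, h2]⟩
      rw [lin_comp, h1, pow_succ']
      rfl
  -- The exponent `n + 1` is positive even if `n = 0`, so the range of this power lies in the range
  -- of `g`.
  obtain ⟨ψ, hψ, hψπ⟩ := hpow (n + 1)
  have hc : IsCompl (LinearMap.ker (lin ψ)) (LinearMap.range (lin ψ)) :=
    hψ ▸ hn (n + 1) (Nat.le_succ n)
  let ι := P.incl _ (range_isHomogeneous ψ)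
  have hιr : LinearMap.range (lin ι) = LinearMap.range (lin ψ) := range_incl _ _ _
  have hιi : Function.Injective (lin ι) := incl_injective _ _ _
  let ρ := liftOfInjective ι hιi ψ hιr.ge
  have hρ (x) : lin ι (lin ρ x) = lin ψ x := lin_liftOfInjective ..
  -- The restriction of `ψ` to its own range is injective because the range meets the kernel
  -- trivially; being an endomorphism in finite dimension it is invertible, and its inverse corrects
  -- `ρ` to a retraction.
  have hinj : Function.Injective (lin (ι ≫ ρ)) := by
    rw [← LinearMap.ker_eq_bot, eq_bot_iff]
    intro x hx
    have h0 : lin ψ (lin ι x) = 0 := by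
      rw [← hρ]
      change lin ι (lin (ι ≫ ρ) x) = 0
      rw [LinearMap.mem_ker.1 hx, map_zero]
    have h1 : lin ι x ∈ LinearMap.range (lin ι) := ⟨x, rfl⟩
    rw [hιr] at h1
    have : lin ι x ∈ LinearMap.ker (lin ψ) ⊓ LinearMap.range (lin ψ) := ⟨h0, h1⟩
    rw [hc.inf_eq_bot] at this
    exact hιi (this.trans (map_zero _).symm)
  have hbij : Function.Bijective (lin (ι ≫ ρ)) := ⟨hinj,
    (LinearMap.injective_iff_surjective (f := (lin (ι ≫ ρ)).restrictScalars K)).1 hinj⟩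
  let e := isoOfBijective _ hbij
  have hle := hmin _ (ι ≫ π) ?_ ⟨(Retract.mk ι (ρ ≫ e.inv) (by
    rw [← Category.assoc]; exact e.hom_inv_id)).trans r⟩
  · have hr : (LinearMap.range (lin ψ)).restrictScalars K = ⊤ :=
      Submodule.eq_top_of_finrank_eq (le_antisymm (Submodule.finrank_le _) hle)
    refine epi_of_surjective g fun x => ?_
    obtain ⟨y, hy⟩ : x ∈ (LinearMap.range (lin ψ)).restrictScalars K := hr ▸ trivial
    refine ⟨lin s ((φ ^ n) y), ?_⟩
    rw [← hy, hψ, pow_succ']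
    rfl
  · have : Epi (ρ ≫ ι ≫ π) := by
      have h : ρ ≫ ι = ψ := hom_ext hρ
      rw [← Category.assoc, h, hψπ]
      exact hπ
    exact epi_of_epi ρ _

end Projective

end GrMod

/-! ### Simple graded $T$-modules and the weight poset -/

namespace TriangularDecomposition

open GrMod

variable {K : Type v} [Field K] {A : Type u} [Ring A] [Algebra K A] {𝒜 : ℤ → Submodule K A}
  [GradedAlgebra 𝒜] {𝒯 : TriangularDecomposition 𝒜}

lemma mem_gradT_zero (t : 𝒯.T) : t ∈ 𝒯.gradT 0 := 𝒯.T_degree t t.2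

lemma smul_mem_gr_gradT (M : GrMod 𝒯.gradT) (t : 𝒯.T) {i : ℤ} {m : M} (hm : m ∈ M.gr i) :
    t • m ∈ M.gr i := by
  have := M.smul_mem (mem_gradT_zero t) hm
  rwa [zero_add] at this

lemma smul_mem_gr (M : GrMod 𝒜) (t : 𝒯.T) {i : ℤ} {m : M} (hm : m ∈ M.gr i) :
    t • m ∈ M.gr i := by
  have := M.smul_mem (𝒯.T_degree t t.2) hm
  rwa [zero_add] at this

section Concentrated

variable (𝒯) (S : Type u) [AddCommGroup S] [Module K S] (d : ℤ)

lemma concentrated_isInternal :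
    DirectSum.IsInternal fun i => if i = d then (⊤ : Submodule K S) else ⊥ := by
  refine isInternal_of_proj _ (fun i => if i = d then LinearMap.id else 0) ?_ ?_ ?_
  · intro i x hx
    by_cases h : i = d
    · simp [h]
    · simpa [h, eq_comm] using hx
  · intro i j hij x hx
    by_cases h : i = d
    · have h' : j ≠ d := fun h' => hij (h.trans h'.symm)
      simpa [h, h'] using hx
    · simp [h]
  · exact eq_top_iff.2 (le_iSup_of_le d (by simp))

variable [Module 𝒯.T S] [IsScalarTower K 𝒯.T S] [Module.Finite 𝒯.T S]

/-- A `T`-module as a graded module concentrated in degree `d`. -/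
def concentrated : GrMod 𝒯.gradT where
  carrier := S
  gr i := if i = d then ⊤ else ⊥
  decomp := (concentrated_isInternal S d).chooseDecomposition
  smul_mem {i j t m} ht hm := by
    by_cases hi : i = 0
    · subst hi
      rw [zero_add]
      by_cases hj : j = d
      · simp [hj]
      · simp only [hj, if_false, Submodule.mem_bot] at hm ⊢
        rw [hm, smul_zero]
    · have : (t : A) = 0 := eq_zero_of_mem_gr_of_mem_gr ht (𝒯.T_degree t t.2) hi
      have : t = 0 := Subtype.ext this
      rw [this, zero_smul]
      exact zero_mem _

variable [FiniteDimensional K A]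

lemma simple_concentrated [h : IsSimpleModule 𝒯.T S] : Simple (𝒯.concentrated S d) :=
  simple_iff.2 ⟨IsSimpleModule.nontrivial 𝒯.T S, fun N _ hN =>
    (h.toIsSimpleOrder.eq_bot_or_eq_top N).resolve_left hN⟩

end Concentrated

lemma degree_eq {M : GrMod 𝒯.gradT} [Nontrivial M] {d : ℤ} (h : ∀ i, i ≠ d → M.gr i = ⊥) :
    M.degree = d := by
  have : {i | M.gr i ≠ ⊥} = {d} := by
    ext i
    refine ⟨fun hi => by_contra fun hne => hi (h i hne), ?_⟩
    rintro rfl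
    obtain ⟨j, hj⟩ := exists_gr_ne_bot (𝒱 := M.gr)
    have : j = i := by_contra fun hne => hj (h j hne)
    rwa [← this]
  rw [degree, this, csSup_singleton]

/-- A chosen simple graded `T`-module representing a weight. -/
abbrev Weight.rep (a : 𝒯.Weight) : GrMod 𝒯.gradT := Irr.rep (C := GrMod 𝒯.gradT) a

lemma simple_rep (a : 𝒯.Weight) : Simple a.rep := (Quotient.out a).2

variable [FiniteDimensional K A]

/-- As $T$ sits in degree zero, each component is a graded submodule, so a nonzero one is
everything. In a module concentrated in one degree every submodule is homogeneous, whence graded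
simplicity is ordinary simplicity. -/
lemma exists_gr_eq_top {M : GrMod 𝒯.gradT} (hM : Simple M) :
    IsSimpleModule 𝒯.T M ∧ ∃ d, M.gr d = ⊤ ∧ ∀ i, i ≠ d → M.gr i = ⊥ := by
  obtain ⟨hnt, h⟩ := simple_iff.1 hM
  obtain ⟨d, hd⟩ := exists_gr_ne_bot (𝒱 := M.gr)
  let N : Submodule 𝒯.T M :=
    { (M.gr d).toAddSubmonoid with smul_mem' := fun t m hm => smul_mem_gr_gradT M t hm }
  have hN : N = ⊤ := by
    refine h N (fun i m hm => ?_) fun h0 => hd ?_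
    · rw [← projComp_apply]
      by_cases hi : d = i
      · subst hi
        exact projComp_mem _ _ _
      · rw [projComp_of_mem_ne hm hi]
        exact zero_mem _
    · rw [eq_bot_iff]
      intro x hx
      have : x ∈ N := hx
      rwa [h0] at this
  have hd' (x : M) : x ∈ M.gr d := by
    have : x ∈ N := hN ▸ trivial
    exact this
  have hi' (i : ℤ) (hi : i ≠ d) : M.gr i = ⊥ := by
    rw [eq_bot_iff]
    exact fun x hx => eq_zero_of_mem_gr_of_mem_gr hx (hd' x) hi
  refine ⟨?_, d, eq_top_iff.2 fun x _ => hd' x, hi'⟩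
  have : IsSimpleOrder (Submodule 𝒯.T M) :=
    { eq_bot_or_eq_top := fun N => by
        by_cases hb : N = ⊥
        · exact Or.inl hb
        · refine Or.inr (h N (fun i m hm => ?_) hb)
          rw [← projComp_apply]
          exact M.projComp_mem_of_mem_gr N (hd' m) hm i }
  exact ⟨⟩

instance isSimpleModule_rep (a : 𝒯.Weight) : IsSimpleModule 𝒯.T (a.rep) :=
  (exists_gr_eq_top (simple_rep a)).1

instance nontrivial_rep (a : 𝒯.Weight) : Nontrivial (a.rep) :=
  IsSimpleModule.nontrivial 𝒯.T _

lemma gr_rep (a : 𝒯.Weight) : (a.rep).gr a.deg = ⊤ := by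
  obtain ⟨d, hd, h⟩ := (exists_gr_eq_top (simple_rep a)).2
  rwa [Weight.deg, degree_eq h]

lemma gr_rep_of_ne (a : 𝒯.Weight) {i : ℤ} (hi : i ≠ a.deg) : (a.rep).gr i = ⊥ := by
  obtain ⟨d, hd, h⟩ := (exists_gr_eq_top (simple_rep a)).2
  rw [Weight.deg, degree_eq h] at hi
  exact h i hi

lemma mem_gr_rep (a : 𝒯.Weight) (x : a.rep) : x ∈ (a.rep).gr a.deg := gr_rep a ▸ trivial

variable (𝒯) in
lemma exists_weight (S : Type u) [AddCommGroup S] [Module K S] [Module 𝒯.T S]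
    [IsScalarTower K 𝒯.T S] [IsSimpleModule 𝒯.T S] (d : ℤ) :
    ∃ a : 𝒯.Weight, a.deg = d ∧ Nonempty (a.rep ≃ₗ[𝒯.T] S) := by
  have : Nontrivial S := IsSimpleModule.nontrivial 𝒯.T S
  let X : {X : GrMod 𝒯.gradT // Simple X} := ⟨𝒯.concentrated S d, 𝒯.simple_concentrated S d⟩
  let a : 𝒯.Weight := (Quotient.mk (simpleSetoid _) X : Irr _)
  obtain ⟨e⟩ : Nonempty (a.rep ≅ 𝒯.concentrated S d) :=
    Quotient.exact (Quotient.out_eq (Quotient.mk (simpleSetoid _) X))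
  have he : Function.Bijective (lin e.hom) := bijective_of_isIso e.hom
  refine ⟨a, ?_, ⟨LinearEquiv.ofBijective (lin e.hom) he⟩⟩
  by_contra hne
  obtain ⟨x, hx⟩ := exists_ne (0 : a.rep)
  have h := lin_mem e.hom (mem_gr_rep a x)
  have h0 : (𝒯.concentrated S d).gr a.deg = ⊥ := if_neg hne
  rw [h0, Submodule.mem_bot] at h
  exact hx (he.1 (h.trans (map_zero _).symm))

/-- A linear isomorphism between modules concentrated in the same degree automatically preserves the
grading. -/
lemma weight_ext {a b : 𝒯.Weight} (hd : a.deg = b.deg) (e : a.rep ≃ₗ[𝒯.T] b.rep) :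
    a = b := by
  have i : a.rep ≅ b.rep := isoOfBijective (ofLin e.toLinearMap fun i x hx => by
    by_cases hi : i = a.deg
    · subst hi
      rw [hd]
      exact mem_gr_rep b _
    · rw [gr_rep_of_ne a hi, Submodule.mem_bot] at hx
      rw [hx, map_zero]
      exact zero_mem _) e.bijective
  exact (Quotient.out_eq a).symm.trans
    ((Quotient.sound (s := simpleSetoid (GrMod 𝒯.gradT)) ⟨i⟩).trans (Quotient.out_eq b))

variable (𝒯) in
/-- A homogeneous component of a graded module as a `T`-submodule. -/
def grT (M : GrMod 𝒜) (d : ℤ) : Submodule 𝒯.T M :=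
  { (M.gr d).toAddSubmonoid with smul_mem' := fun t _ hm => smul_mem_gr M t hm }

/-- The component of degree `d` is a nonzero Artinian $T$-module, so it contains a simple submodule.
-/
lemma exists_weight_map (M : GrMod 𝒜) {d : ℤ} (hd : M.gr d ≠ ⊥) :
    ∃ a : 𝒯.Weight, a.deg = d ∧ ∃ j : a.rep →ₗ[𝒯.T] M, Function.Injective j ∧
      ∀ x, j x ∈ M.gr d := by
  have : IsArtinian 𝒯.T M := isArtinian_of_tower K inferInstance
  have hne : 𝒯.grT M d ≠ ⊥ := fun h0 => hd <| by
    rw [eq_bot_iff]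
    intro x hx
    have : x ∈ 𝒯.grT M d := hx
    rwa [h0] at this
  obtain ⟨S, hS, hle⟩ := (eq_bot_or_exists_atom_le (𝒯.grT M d)).resolve_left hne
  have := isSimpleModule_iff_isAtom.2 hS
  obtain ⟨a, ha, ⟨e⟩⟩ := 𝒯.exists_weight S d
  exact ⟨a, ha, S.subtype ∘ₗ e.toLinearMap, S.injective_subtype.comp e.injective,
    fun x => hle (e x).2⟩

/-- A weight is determined by its degree and its isotypic component in $T$, and a semisimple ring
has finitely many isotypic components. -/
lemma finite_weights [IsSemisimpleRing 𝒯.T] (m n : ℤ) :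
    {a : 𝒯.Weight | m ≤ a.deg ∧ a.deg ≤ n}.Finite := by
  have hex (a : 𝒯.Weight) : ∃ S : Submodule 𝒯.T 𝒯.T, Nonempty (a.rep ≃ₗ[𝒯.T] S) :=
    IsSemisimpleRing.exists_linearEquiv_ideal_of_isSimpleModule 𝒯.T a.rep
  refine Set.Finite.of_finite_image (f := fun a => (a.deg, isotypicComponent 𝒯.T 𝒯.T a.rep))
    (((Set.finite_Icc m n).prod (Set.toFinite (isotypicComponents 𝒯.T 𝒯.T))).subset ?_) ?_
  · rintro _ ⟨a, ha, rfl⟩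
    obtain ⟨S, ⟨e⟩⟩ := hex a
    exact ⟨ha, S, IsSimpleModule.congr e.symm, e.isotypicComponent_eq⟩
  · intro a _ b _ h
    obtain ⟨S, ⟨e⟩⟩ := hex a
    have := IsSimpleModule.congr e.symm
    have (m : {m : Submodule 𝒯.T 𝒯.T | Nonempty (m ≃ₗ[𝒯.T] b.rep)}) : IsSimpleModule 𝒯.T m :=
      IsSimpleModule.congr m.2.some
    obtain ⟨hd, hc⟩ := Prod.ext_iff.1 h
    dsimp only at hd hc
    have hle : S ≤ isotypicComponent 𝒯.T 𝒯.T b.rep := by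
      rw [← hc, e.isotypicComponent_eq]
      exact S.le_isotypicComponent
    -- A simple submodule of a sum of copies of `b.rep` is isomorphic to one of the summands.
    obtain ⟨m, ⟨e₁⟩, ⟨e₂⟩⟩ := S.linearEquiv_of_le_sSup _ hle
    exact weight_ext hd (e ≪≫ₗ e₂ ≪≫ₗ e₁)

lemma finite_Icc [IsSemisimpleRing 𝒯.T] (a b : 𝒯.Weight) : (Set.Icc a b).Finite := by
  refine (finite_weights a.deg b.deg).subset ?_
  rintro x ⟨h1, h2⟩
  exact ⟨h1.elim (fun h => h ▸ le_rfl) le_of_lt, h2.elim (fun h => h ▸ le_rfl) le_of_lt⟩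

end TriangularDecomposition

/-! ### Graded modules generated by any nonzero vector of one component -/

namespace GrMod

variable {K : Type v} [Field K] {A : Type u} [Ring A] [Algebra K A] {𝒜 : ℤ → Submodule K A}

/-- `M` is generated by each nonzero element of its nonzero component of degree `d`. -/
structure IsLocalIn (M : GrMod 𝒜) (d : ℤ) : Prop where
  ne_bot : M.gr d ≠ ⊥
  span_eq_top : ∀ x ∈ M.gr d, x ≠ 0 → Submodule.span A {x} = ⊤

/-- The largest submodule of `M` whose component of degree `d` vanishes. -/
def core (M : GrMod 𝒜) (d : ℤ) : Submodule A M where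
  carrier := {x | ∀ a : A, projComp M.gr d (a • x) = 0}
  add_mem' hx hy a := by rw [smul_add, map_add, hx a, hy a, add_zero]
  zero_mem' a := by rw [smul_zero, map_zero]
  smul_mem' b x hx a := by rw [smul_smul]; exact hx _

lemma mem_core {M : GrMod 𝒜} {d : ℤ} {x : M} :
    x ∈ M.core d ↔ ∀ a : A, projComp M.gr d (a • x) = 0 := Iff.rfl

lemma eq_zero_of_mem_core {M : GrMod 𝒜} {d : ℤ} {x : M} (hx : x ∈ M.core d)
    (hd : x ∈ M.gr d) : x = 0 := by
  have := hx 1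
  rwa [one_smul, projComp_of_mem hd] at this

lemma core_isHomogeneous [GradedAlgebra 𝒜] (M : GrMod 𝒜) (d : ℤ) :
    (M.core d).IsHomogeneous M.gr := by
  intro n x hx
  rw [mem_core]
  intro a
  rw [← projComp_apply]
  induction a using DirectSum.Decomposition.inductionOn 𝒜 with
  | zero => rw [zero_smul, map_zero]
  | add a b ha hb => rw [add_smul, map_add, ha, hb, add_zero]
  | @homogeneous i a =>
    rw [projComp_smul M a.2]
    by_cases h : n = d - i
    · subst h
      rw [projComp_of_mem (projComp_mem _ _ _), ← projComp_smul M a.2]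
      exact hx a
    · rw [projComp_of_mem_ne (projComp_mem _ _ _) h, smul_zero]

namespace IsLocalIn

variable {M : GrMod 𝒜} {d : ℤ}

/-- If some `a • x` had a nonzero component in degree `d`, that component would lie in `N` and
generate `M`. -/
lemma le_core (h : M.IsLocalIn d) {N : Submodule A M} (hN : N.IsHomogeneous M.gr) (hne : N ≠ ⊤) :
    N ≤ M.core d := by
  intro x hx a
  by_contra h0
  apply hne
  rw [eq_top_iff, ← h.span_eq_top _ (projComp_mem _ _ _) h0, Submodule.span_singleton_le_iff_mem]
  exact hN d (N.smul_mem a hx)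

lemma core_ne_top (h : M.IsLocalIn d) : M.core d ≠ ⊤ := fun h0 => h.ne_bot <| by
  rw [eq_bot_iff]
  exact fun x hx => eq_zero_of_mem_core (h0 ▸ Submodule.mem_top) hx

variable [GradedAlgebra 𝒜]

/-- The core contains every proper graded submodule, so it is the only maximal one. -/
lemma radical_eq (h : M.IsLocalIn d) : M.radical = M.core d := by
  refine le_antisymm (sInf_le ⟨core_isHomogeneous M d, h.core_ne_top, fun N hN hlt => ?_⟩)
    (le_sInf fun N hN => ?_)
  · by_contra hne
    exact hlt.not_ge (h.le_core hN hne)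
  · by_contra hle
    have hlt : N < M.core d := lt_of_le_of_ne (h.le_core hN.1 hN.2.1) fun he => hle he.ge
    exact h.core_ne_top (hN.2.2 _ (core_isHomogeneous M d) hlt)

end IsLocalIn

/-- The projection onto the head. -/
def toHead (M : GrMod 𝒜) : M ⟶ M.head := M.mkQ M.radical M.radical_isHomogeneous

lemma toHead_surjective (M : GrMod 𝒜) : Function.Surjective (lin M.toHead) :=
  M.mkQ_surjective _ _

lemma ker_toHead (M : GrMod 𝒜) : LinearMap.ker (lin M.toHead) = M.radical := M.ker_mkQ _ _

namespace IsLocalIn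

variable {M : GrMod 𝒜} {d : ℤ} [GradedAlgebra 𝒜]

lemma toHead_eq_zero (h : M.IsLocalIn d) {x : M} (hx : x ∈ M.gr d) (h0 : lin M.toHead x = 0) :
    x = 0 := by
  rw [← LinearMap.mem_ker, ker_toHead, h.radical_eq] at h0
  exact eq_zero_of_mem_core h0 hx

lemma simple_head [FiniteDimensional K A] (h : M.IsLocalIn d) : Simple M.head := by
  refine simple_iff.2 ⟨?_, fun N hN hne => ?_⟩
  · obtain ⟨x, hx, hx0⟩ := (Submodule.ne_bot_iff _).1 h.ne_bot
    exact ⟨lin M.toHead x, 0, fun h0 => hx0 (h.toHead_eq_zero hx h0)⟩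
  · by_contra hnt
    refine hne (eq_bot_iff.2 fun y hy => ?_)
    obtain ⟨x, rfl⟩ := M.toHead_surjective y
    have hle : N.comap (lin M.toHead) ≤ M.core d :=
      h.le_core (comap_isHomogeneous _ hN) fun ht => hnt (eq_top_iff.2 fun y _ => by
        obtain ⟨x, rfl⟩ := M.toHead_surjective y
        have : x ∈ N.comap (lin M.toHead) := ht ▸ trivial
        exact this)
    have hx : x ∈ LinearMap.ker (lin M.toHead) := by
      rw [ker_toHead, h.radical_eq]
      exact hle hy
    exact hx

lemma surjective_of_toHead_ne_zero (h : M.IsLocalIn d) {P : GrMod 𝒜} (f : P ⟶ M)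
    (hf : f ≫ M.toHead ≠ 0) : Function.Surjective (lin f) := by
  rw [← LinearMap.range_eq_top]
  by_contra hne
  refine hf (hom_ext fun x => ?_)
  have hx : lin f x ∈ LinearMap.ker (lin M.toHead) := by
    rw [ker_toHead, h.radical_eq]
    exact h.le_core (range_isHomogeneous f) hne ⟨x, rfl⟩
  exact hx

/-- A simple quotient of a local graded module is isomorphic to the head. -/
def headIso (h : M.IsLocalIn d) [FiniteDimensional K A] {S : GrMod 𝒜} (hS : Simple S) (f : M ⟶ S)
    (hf : f ≠ 0) : M.head ≅ S :=
  have hs : Function.Surjective (lin f) := by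
    rw [← LinearMap.range_eq_top]
    refine (simple_iff.1 hS).2 _ (range_isHomogeneous f) fun hb => hf (hom_ext fun x => ?_)
    exact LinearMap.congr_fun (LinearMap.range_eq_bot.1 hb) x
  have hle : LinearMap.ker (lin M.toHead) ≤ LinearMap.ker (lin f) := by
    rw [ker_toHead]
    -- The kernel of `f` is one of the maximal graded submodules whose intersection is the radical.
    refine sInf_le ⟨ker_isHomogeneous f, fun ht => hf (hom_ext fun x => ?_), fun N hN hlt => ?_⟩
    · have : x ∈ LinearMap.ker (lin f) := ht ▸ trivial
      exact this
    · by_contra hne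
      obtain ⟨x, hxN, hx⟩ := Set.exists_of_ssubset hlt
      have hmap : N.map (lin f) = ⊤ := by
        refine (simple_iff.1 hS).2 _ ?_ fun hb => hx ?_
        · rintro i _ ⟨y, hy, rfl⟩
          exact ⟨projComp M.gr i y, hN i hy, lin_projComp f i y⟩
        · have : lin f x ∈ N.map (lin f) := ⟨x, hxN, rfl⟩
          rw [hb] at this
          exact this
      refine hne (eq_top_iff.2 fun y _ => ?_)
      obtain ⟨z, hz, hzy⟩ : lin f y ∈ N.map (lin f) := hmap ▸ trivial
      have : y - z ∈ N := hlt.le (by rw [LinearMap.mem_ker, map_sub, hzy, sub_self])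
      simpa using add_mem this hz
  isoOfBijective (descOfSurjective M.toHead M.toHead_surjective f hle) <| by
    have hl := lin_descOfSurjective M.toHead M.toHead_surjective f hle
    refine ⟨?_, fun y => ?_⟩
    · have hinj :
          LinearMap.ker (lin (descOfSurjective M.toHead M.toHead_surjective f hle)) = ⊥ := by
        by_contra hb
        have ht := (simple_iff.1 h.simple_head).2 _ (ker_isHomogeneous _) hb
        refine hf (hom_ext fun x => ?_)
        rw [← hl]
        have : lin M.toHead x ∈
          LinearMap.ker (lin (descOfSurjective M.toHead M.toHead_surjective f hle)) := ht ▸ trivial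
        exact this
      exact LinearMap.ker_eq_bot.1 hinj
    · obtain ⟨x, rfl⟩ := hs y
      exact ⟨lin M.toHead x, hl x⟩

end IsLocalIn

end GrMod

/-! ### Generators and universal property of $A\otimes_{B^+}M$ -/

namespace TriangularDecomposition

open GrMod

variable {K : Type v} [Field K] {A : Type u} [Ring A] [Algebra K A] {𝒜 : ℤ → Submodule K A}
  [GradedAlgebra 𝒜] {𝒯 : TriangularDecomposition 𝒜} [FiniteDimensional K A]

section ProperStandard

variable (M : GrMod 𝒯.gradT)

/-- The quotient map `A ⊗[K] M → A ⊗_{B⁺} M`. -/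
def standardMk : A ⊗[K] M →ₗ[A] 𝒯.properStandard M := ((𝒯.relationSubmodule M).mkQ :)

lemma standardMk_surjective : Function.Surjective (standardMk M) :=
  (𝒯.relationSubmodule M).mkQ_surjective

lemma standardMk_eq_zero {x : A ⊗[K] M} (hx : x ∈ 𝒯.relations M) : standardMk M x = 0 :=
  (Submodule.Quotient.mk_eq_zero _).2 (Submodule.subset_span hx)

/-- The canonical map `M → A ⊗_{B⁺} M`. -/
def gen : M →ₗ[𝒯.T] 𝒯.properStandard M where
  toFun m := standardMk M (1 ⊗ₜ m)
  map_add' x y := by rw [TensorProduct.tmul_add, map_add]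
  map_smul' t m := by
    have := standardMk_eq_zero M (Or.inl ⟨t, m, rfl⟩)
    rw [map_sub, sub_eq_zero] at this
    rw [← this, RingHom.id_apply]
    change _ = (t : A) • standardMk M (1 ⊗ₜ m)
    rw [← map_smul, TensorProduct.smul_tmul', smul_eq_mul, mul_one]

lemma gen_apply (m : M) : gen M m = standardMk M (1 ⊗ₜ m) := rfl

lemma standardMk_tmul (a : A) (m : M) : standardMk M (a ⊗ₜ m) = a • gen M m := by
  rw [gen_apply, ← map_smul, TensorProduct.smul_tmul', smul_eq_mul, mul_one]

lemma gen_mem {i : ℤ} {m : M} (hm : m ∈ M.gr i) : gen M m ∈ (𝒯.properStandard M).gr i := by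
  have := tmul_mem_tensorGr M.gr (SetLike.one_mem_graded 𝒜) hm
  rw [zero_add] at this
  exact ⟨_, this, rfl⟩

lemma span_range_gen : Submodule.span A (Set.range (gen M)) = ⊤ := by
  rw [eq_top_iff]
  intro x _
  obtain ⟨x, rfl⟩ := standardMk_surjective M x
  induction x using TensorProduct.induction_on with
  | zero => rw [map_zero]; exact zero_mem _
  | add x y hx hy => rw [map_add]; exact add_mem (hx trivial) (hy trivial)
  | tmul a m =>
    rw [standardMk_tmul]
    exact Submodule.smul_mem _ _ (Submodule.subset_span ⟨m, rfl⟩)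

lemma smul_gen_eq_zero {i : ℤ} (hi : 0 < i) {b : A} (hb : b ∈ 𝒯.borel) (hbi : b ∈ 𝒜 i) (m : M) :
    b • gen M m = 0 := by
  rw [← standardMk_tmul]
  exact standardMk_eq_zero M (Or.inr ⟨i, hi, b, hb, hbi, m, rfl⟩)

variable {M} in
-- The two kinds of relations are respected because `j` is $T$-linear and because its image is
-- killed by $J^+$; this is the adjunction defining induction from $B^+$.
lemma exists_desc {N : GrMod 𝒜} (j : M →ₗ[𝒯.T] N) (hj : ∀ i, ∀ m ∈ M.gr i, j m ∈ N.gr i)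
    (hb : ∀ i, 0 < i → ∀ b ∈ 𝒯.borel, b ∈ 𝒜 i → ∀ m, b • j m = 0) :
    ∃ f : 𝒯.properStandard M ⟶ N, ∀ m, lin f (gen M m) = j m := by
  let φ : A ⊗[K] M →ₗ[A] N := tensorLift (j.restrictScalars K)
  have hφ : 𝒯.relationSubmodule M ≤ LinearMap.ker (φ : tensorGrMod 𝒜 M.gr →ₗ[A] N) := by
    refine Submodule.span_le.2 ?_
    rintro x (⟨t, m, rfl⟩ | ⟨i, hi, b, hbb, hbi, m, rfl⟩)
    · change φ _ = 0
      rw [map_sub, tensorLift_tmul, tensorLift_tmul, one_smul, sub_eq_zero]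
      exact (j.map_smul t m).symm
    · exact hb i hi b hbb hbi m
  refine ⟨ofLin (M := 𝒯.properStandard M) ((𝒯.relationSubmodule M).liftQ φ hφ) ?_, fun m => ?_⟩
  · rintro i _ ⟨x, hx, rfl⟩
    exact tensorLift_mem M.gr (j.restrictScalars K) hj i x hx
  · exact one_smul A (j m)

end ProperStandard

end TriangularDecomposition

/-! ### Dimensions of products of subspaces -/

section Smul

variable {K : Type v} [Field K] {A : Type u} [Ring A] [Algebra K A]
  {M : Type u} [AddCommGroup M] [Module K M] [Module A M] [IsScalarTower K A M]

/-- The product is the image of $U\otimes_K V$. All upper bounds in the dimension counts come from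
here. -/
lemma finrank_smul_le [FiniteDimensional K A] [FiniteDimensional K M] (U : Submodule K A)
    (V : Submodule K M) :
    Module.finrank K ↥(U • V) ≤ Module.finrank K U * Module.finrank K V := by
  let φ : U ⊗[K] V →ₗ[K] M := TensorProduct.lift
    (((Algebra.lsmul K K M).toLinearMap.domRestrict U).compl₂ V.subtype)
  have hle : U • V ≤ LinearMap.range φ := Submodule.smul_le.2 fun r hr x hx =>
    ⟨(⟨r, hr⟩ : U) ⊗ₜ (⟨x, hx⟩ : V), rfl⟩
  calc _ ≤ Module.finrank K (LinearMap.range φ) := Submodule.finrank_mono hle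
    _ ≤ Module.finrank K (U ⊗[K] V) := LinearMap.finrank_range_le φ
    _ = _ := Module.finrank_tensorProduct

lemma restrictScalars_span_eq_top_smul (S : Submodule K M) :
    (Submodule.span A (S : Set M)).restrictScalars K = (⊤ : Submodule K A) • S := by
  refine le_antisymm (fun x hx => ?_)
    (Submodule.smul_le.2 fun r _ x hx => Submodule.smul_mem _ _ (Submodule.subset_span hx))
  rw [Submodule.restrictScalars_mem] at hx
  induction hx using Submodule.span_induction with
  | mem x hx =>
    rw [← one_smul A x]
    exact Submodule.smul_mem_smul trivial hx
  | zero => exact zero_mem _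
  | add x y _ _ hx hy => exact add_mem hx hy
  | smul a x hs hx =>
    clear hs
    induction hx using Submodule.smul_induction_on' with
    | smul r hr n hn =>
      rw [smul_smul]
      exact Submodule.smul_mem_smul trivial hn
    | add x _ y _ hx' hy' =>
      rw [smul_add]
      exact add_mem hx' hy'

lemma map_smul_submodule {N : Type u} [AddCommGroup N] [Module K N] [Module A N]
    [IsScalarTower K A N] (f : M →ₗ[A] N) (U : Submodule K A) (V : Submodule K M) :
    (U • V).map (f.restrictScalars K) = U • V.map (f.restrictScalars K) := by
  refine le_antisymm ?_ (Submodule.smul_le.2 ?_)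
  · rw [Submodule.map_le_iff_le_comap]
    refine Submodule.smul_le.2 fun r hr x hx => ?_
    rw [Submodule.mem_comap, LinearMap.restrictScalars_apply, map_smul]
    exact Submodule.smul_mem_smul hr ⟨x, hx, rfl⟩
  · rintro r hr _ ⟨x, hx, rfl⟩
    exact ⟨r • x, Submodule.smul_mem_smul hr hx, map_smul f r x⟩

end Smul

/-! ### Truncations of the grading -/

namespace GrMod

variable {K : Type v} [Field K] {A : Type u} [Ring A] [Algebra K A] {𝒜 : ℤ → Submodule K A}
  (M : GrMod 𝒜)

/-- The subspace `⨁_{i < k} M_i`. -/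
def lower (k : ℤ) : Submodule K M := ⨆ (i : ℤ) (_ : i < k), M.gr i

/-- The subspace `⨁_{k < i} M_i`. -/
def upper (k : ℤ) : Submodule K M := ⨆ (i : ℤ) (_ : k < i), M.gr i

variable {M} in
lemma projComp_of_mem_lower {k n : ℤ} (h : k ≤ n) {x : M} (hx : x ∈ lower M k) :
    projComp M.gr n x = 0 := by
  have : lower M k ≤ LinearMap.ker (projComp M.gr n) := iSup₂_le fun i hi y hy =>
    projComp_of_mem_ne hy (by omega)
  exact this hx

variable {M} in
lemma projComp_of_mem_upper {k n : ℤ} (h : n ≤ k) {x : M} (hx : x ∈ upper M k) :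
    projComp M.gr n x = 0 := by
  have : upper M k ≤ LinearMap.ker (projComp M.gr n) := iSup₂_le fun i hi y hy =>
    projComp_of_mem_ne hy (by omega)
  exact this hx

lemma gr_le_lower {i k : ℤ} (h : i < k) : M.gr i ≤ lower M k :=
  le_iSup₂_of_le i h le_rfl

lemma gr_le_upper {i k : ℤ} (h : k < i) : M.gr i ≤ upper M k :=
  le_iSup₂_of_le i h le_rfl

lemma smul_isHomogeneous {U : ℤ → Submodule K A} (hU : ∀ i, U i ≤ 𝒜 i) {p : ℤ → Prop} {n : ℤ}
    {x : M} (hx : x ∈ (⨆ (i : ℤ) (_ : p i), U i) • (⊤ : Submodule K M)) :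
    projComp M.gr n x ∈ (⨆ (i : ℤ) (_ : p i), U i) • (⊤ : Submodule K M) := by
  have : (⨆ (i : ℤ) (_ : p i), U i) • (⊤ : Submodule K M) ≤
      ((⨆ (i : ℤ) (_ : p i), U i) • (⊤ : Submodule K M)).comap (projComp M.gr n) := by
    conv_lhs => simp only [Submodule.iSup_smul]
    refine iSup₂_le fun i hi => Submodule.smul_le.2 fun a ha x _ => ?_
    rw [Submodule.mem_comap, projComp_smul M (hU i ha)]
    exact Submodule.smul_mem_smul (Submodule.mem_iSup_of_mem i (Submodule.mem_iSup_of_mem hi ha))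
      trivial
  exact this hx

lemma exists_lower_eq [FiniteDimensional K A] : (∃ k, lower M k = ⊥) ∧ ∃ k, lower M k = ⊤ := by
  have hf := finite_gr_ne_bot (𝒱 := M.gr)
  constructor
  · obtain ⟨k, hk⟩ := hf.bddBelow
    refine ⟨k, eq_bot_iff.2 (iSup₂_le fun i hi => ?_)⟩
    by_contra hne
    exact (hk (fun h => hne h.le)).not_gt hi
  · obtain ⟨k, hk⟩ := hf.bddAbove
    refine ⟨k + 1, eq_top_iff.2 ?_⟩
    rw [← (DirectSum.Decomposition.isInternal M.gr).submodule_iSup_eq_top]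
    refine iSup_le fun i => ?_
    by_cases h : M.gr i = ⊥
    · rw [h]; exact bot_le
    · have := hk h
      exact gr_le_lower M (by omega)

end GrMod

/-! ### The factorisation $A=A^-B^+$ and Nakayama's lemma for $A^-$ -/

namespace TriangularDecomposition

open GrMod Module

variable {K : Type v} [Field K] {A : Type u} [Ring A] [Algebra K A] {𝒜 : ℤ → Submodule K A}
  [GradedAlgebra 𝒜] (𝒯 : TriangularDecomposition 𝒜)

/-- The subspace `A⁻` of `A`. -/
abbrev negS : Submodule K A := Subalgebra.toSubmodule 𝒯.neg

/-- The part of `A⁻` of negative degree. -/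
def negJ : Submodule K A := ⨆ (i : ℤ) (_ : i < 0), 𝒯.negS ⊓ 𝒜 i

/-- The part of `B⁺` of positive degree. -/
def posJ : Submodule K A := ⨆ (i : ℤ) (_ : 0 < i), 𝒯.borel ⊓ 𝒜 i

lemma negJ_le : 𝒯.negJ ≤ 𝒯.negS := iSup₂_le fun _ _ => inf_le_left

lemma posJ_le : 𝒯.posJ ≤ 𝒯.borel := iSup₂_le fun _ _ => inf_le_left

lemma one_le_negS : 1 ≤ 𝒯.negS := Submodule.one_le.2 𝒯.neg.one_mem

lemma negS_eq : 𝒯.negS = 1 ⊔ 𝒯.negJ := by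
  refine le_antisymm (fun x hx => ?_) (sup_le 𝒯.one_le_negS 𝒯.negJ_le)
  refine mem_iSup_projComp 𝒜 x _ fun n => ?_
  have hn : projComp 𝒜 n x ∈ 𝒯.neg := 𝒯.neg_homogeneous n hx
  have hn' := projComp_mem 𝒜 n x
  rcases lt_trichotomy n 0 with h | h | h
  · exact Submodule.mem_sup_right
      (Submodule.mem_iSup_of_mem n (Submodule.mem_iSup_of_mem h ⟨hn, hn'⟩))
  · subst h
    obtain ⟨c, hc⟩ := 𝒯.neg_zero _ hn hn'
    rw [hc]
    exact Submodule.mem_sup_left (Submodule.algebraMap_mem c)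
  · by_cases h0 : projComp 𝒜 n x = 0
    · rw [h0]; exact zero_mem _
    · exact absurd (𝒯.neg_degree n _ hn hn' h0) (not_le.2 h)

lemma negS_mul_negS : 𝒯.negS * 𝒯.negS = 𝒯.negS := 𝒯.neg.isIdempotentElem_toSubmodule

lemma T_le_borel : Subalgebra.toSubmodule 𝒯.T ≤ 𝒯.borel := by
  intro t ht
  rw [← one_mul t]
  exact Submodule.mul_mem_mul 𝒯.pos.one_mem ht

/-- The exchange rule $A^+T=TA^+$ lets the two middle factors be swapped, so $B^+$ is closed under
multiplication. -/
lemma borel_mul_borel : 𝒯.borel * 𝒯.borel = 𝒯.borel := by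
  have h1 : (Subalgebra.toSubmodule 𝒯.pos) * (Subalgebra.toSubmodule 𝒯.pos) =
    Subalgebra.toSubmodule 𝒯.pos := 𝒯.pos.isIdempotentElem_toSubmodule
  have h2 : (Subalgebra.toSubmodule 𝒯.T) * (Subalgebra.toSubmodule 𝒯.T) =
    Subalgebra.toSubmodule 𝒯.T := 𝒯.T.isIdempotentElem_toSubmodule
  calc 𝒯.borel * 𝒯.borel
      = Subalgebra.toSubmodule 𝒯.pos * (Subalgebra.toSubmodule 𝒯.T *
        Subalgebra.toSubmodule 𝒯.pos) * Subalgebra.toSubmodule 𝒯.T := by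
        simp only [borel, mul_assoc]
    _ = (Subalgebra.toSubmodule 𝒯.pos * Subalgebra.toSubmodule 𝒯.pos) *
        (Subalgebra.toSubmodule 𝒯.T * Subalgebra.toSubmodule 𝒯.T) := by
        rw [← 𝒯.pos_mul_T]; simp only [mul_assoc]
    _ = 𝒯.borel := by rw [h1, h2]; rfl

/-- Split the factor from $A^+$ into homogeneous parts: degree zero contributes scalars, positive
degrees contribute to $J^+$, and negative degrees do not occur. -/
lemma borel_eq : 𝒯.borel = Subalgebra.toSubmodule 𝒯.T ⊔ 𝒯.posJ := by
  refine le_antisymm (Submodule.mul_le.2 fun c hc t ht => ?_) (sup_le 𝒯.T_le_borel 𝒯.posJ_le)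
  refine mem_iSup_projComp 𝒜 c
    ((Subalgebra.toSubmodule 𝒯.T ⊔ 𝒯.posJ).comap (LinearMap.mulRight K t)) fun n => ?_
  have hn : projComp 𝒜 n c ∈ 𝒯.pos := 𝒯.pos_homogeneous n hc
  have hn' := projComp_mem 𝒜 n c
  rw [Submodule.mem_comap, LinearMap.mulRight_apply]
  rcases lt_trichotomy n 0 with h | h | h
  · by_cases h0 : projComp 𝒜 n c = 0
    · rw [h0, zero_mul]; exact zero_mem _
    · exact absurd (𝒯.pos_degree n _ hn hn' h0) (not_le.2 h)
  · subst h
    obtain ⟨k, hk⟩ := 𝒯.pos_zero _ hn hn'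
    rw [hk]
    exact Submodule.mem_sup_left (𝒯.T.mul_mem (𝒯.T.algebraMap_mem k) ht)
  · refine Submodule.mem_sup_right
      (Submodule.mem_iSup_of_mem n (Submodule.mem_iSup_of_mem h ⟨?_, ?_⟩))
    · exact Submodule.mul_mem_mul hn ht
    · have := SetLike.mul_mem_graded hn' (𝒯.T_degree t ht)
      rwa [add_zero] at this

lemma mul_le_posJ {U : Submodule K A} {i j : ℤ} (hU : U ≤ 𝒯.borel ⊓ 𝒜 i) {V : Submodule K A}
    (hV : V ≤ 𝒯.borel ⊓ 𝒜 j) (hij : 0 < i + j) : U * V ≤ 𝒯.posJ := by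
  refine Submodule.mul_le.2 fun x hx y hy => Submodule.mem_iSup_of_mem (i + j)
    (Submodule.mem_iSup_of_mem hij ⟨?_, SetLike.mul_mem_graded (hU hx).2 (hV hy).2⟩)
  rw [← borel_mul_borel]
  exact Submodule.mul_mem_mul (hU hx).1 (hV hy).1

lemma T_le_inf : Subalgebra.toSubmodule 𝒯.T ≤ 𝒯.borel ⊓ 𝒜 0 :=
  le_inf 𝒯.T_le_borel fun t ht => 𝒯.T_degree t ht

lemma borel_mul_posJ : 𝒯.borel * 𝒯.posJ ≤ 𝒯.posJ := by
  rw [borel_eq, Submodule.sup_mul]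
  refine sup_le ?_ ?_
  · conv_lhs => rw [posJ]
    simp only [Submodule.mul_iSup]
    exact iSup₂_le fun i hi => 𝒯.mul_le_posJ 𝒯.T_le_inf le_rfl (by omega)
  · conv_lhs => rw [posJ]
    simp only [Submodule.mul_iSup, Submodule.iSup_mul]
    exact iSup₂_le fun i hi => iSup₂_le fun j hj => 𝒯.mul_le_posJ le_rfl le_rfl (by omega)

lemma negS_mul_borel : 𝒯.negS * 𝒯.borel = ⊤ := by
  rw [eq_top_iff]
  intro a h
  clear h
  obtain ⟨z, rfl⟩ := 𝒯.mul_bijective.2 a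
  rw [borel, 𝒯.pos_mul_T, ← mul_assoc]
  induction z using TensorProduct.induction_on with
  | zero => rw [map_zero]; exact zero_mem _
  | add x y hx hy => rw [map_add]; exact add_mem hx hy
  | tmul w c =>
    induction w using TensorProduct.induction_on with
    | zero => rw [TensorProduct.zero_tmul, map_zero]; exact zero_mem _
    | add x y hx hy => rw [TensorProduct.add_tmul, map_add]; exact add_mem hx hy
    | tmul x t => exact Submodule.mul_mem_mul (Submodule.mul_mem_mul x.2 t.2) c.2

section FiniteDimensional

variable [FiniteDimensional K A]

/-- Here injectivity of the multiplication map enters: $\dim A=\dim A^-\dim T\dim A^+$, while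
$B^+=A^+T$ is spanned by products. Together with $A=A^-B^+$ it makes the regular module tight. -/
lemma finrank_negS_mul_finrank_borel_le :
    finrank K 𝒯.negS * finrank K 𝒯.borel ≤ finrank K A := by
  have h := (LinearEquiv.ofBijective _ 𝒯.mul_bijective).finrank_eq
  rw [finrank_tensorProduct, finrank_tensorProduct] at h
  rw [← h, mul_assoc]
  refine Nat.mul_le_mul le_rfl ?_
  rw [mul_comm]
  exact finrank_smul_le (Subalgebra.toSubmodule 𝒯.pos) (Subalgebra.toSubmodule 𝒯.T)

variable {𝒯} (M : GrMod 𝒜)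

omit [FiniteDimensional K A] in
-- Since $A=A^-B^+$ and $B^+=T+J^+$, only $A^-$ enlarges a $T$-stable subspace killed by $J^+$.
lemma span_eq_negS_smul {S : Submodule K M} (hT : Subalgebra.toSubmodule 𝒯.T • S ≤ S)
    (hJ : 𝒯.posJ • S = ⊥) :
    (Submodule.span A (S : Set M)).restrictScalars K = 𝒯.negS • S := by
  rw [restrictScalars_span_eq_top_smul, ← 𝒯.negS_mul_borel, ← smul_eq_mul, Submodule.smul_assoc]
  refine le_antisymm (Submodule.smul_mono le_rfl ?_) (Submodule.smul_mono le_rfl ?_)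
  · rw [borel_eq, Submodule.sup_smul, hJ, sup_bot_eq]
    exact hT
  · intro x hx
    rw [← one_smul A x]
    exact Submodule.smul_mem_smul (𝒯.T_le_borel 𝒯.T.one_mem) hx

omit [FiniteDimensional K A] in
lemma posJ_smul_eq_bot {S : Submodule K M}
    (h : ∀ i, 0 < i → ∀ b ∈ 𝒯.borel, b ∈ 𝒜 i → ∀ x ∈ S, b • x = 0) : 𝒯.posJ • S = ⊥ := by
  rw [posJ]
  simp only [Submodule.iSup_smul]
  rw [eq_bot_iff]
  exact iSup₂_le fun i hi => Submodule.smul_le.2 fun b hb x hx => h i hi b hb.1 hb.2 x hx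

omit [FiniteDimensional K A] in
lemma negJ_smul_lower (k : ℤ) : 𝒯.negJ • lower M (k + 1) ≤ lower M k := by
  rw [negJ, lower]
  simp only [Submodule.iSup_smul, Submodule.smul_iSup]
  exact iSup₂_le fun j hj => iSup₂_le fun i hi => Submodule.smul_le.2 fun a ha x hx =>
    gr_le_lower M (i := i + j) (by omega) (M.smul_mem ha.2 hx)

variable (𝒯) in
/-- The subspace `A⁻_{<0} M`. -/
def rad : Submodule K M := 𝒯.negJ • ⊤

omit [FiniteDimensional K A] in
lemma projComp_mem_rad {x : M} (hx : x ∈ rad 𝒯 M) (n : ℤ) : projComp M.gr n x ∈ rad 𝒯 M :=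
  smul_isHomogeneous M (U := fun i => 𝒯.negS ⊓ 𝒜 i) (fun _ => inf_le_right) hx

/-- Graded Nakayama lemma. If $A^-V$ fills $M$ up to degrees $<k+1$, then applying $A^-_{<0}$ lowers
the error to degrees $<k$; as the grading is bounded, the error eventually vanishes. -/
lemma negS_smul_eq_top {V : Submodule K M} (hV : V ⊔ rad 𝒯 M = ⊤) : 𝒯.negS • V = ⊤ := by
  have step (k : ℤ) (h : 𝒯.negS • V ⊔ lower M (k + 1) = ⊤) : 𝒯.negS • V ⊔ lower M k = ⊤ := by
    rw [eq_top_iff, ← hV]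
    refine sup_le ?_ ?_
    · refine le_sup_of_le_left fun x hx => ?_
      rw [← one_smul A x]
      exact Submodule.smul_mem_smul 𝒯.neg.one_mem hx
    · rw [rad, ← h, Submodule.smul_sup]
      refine sup_le_sup ?_ (negJ_smul_lower M k)
      rw [← Submodule.smul_assoc]
      exact Submodule.smul_mono
        ((mul_le_mul' 𝒯.negJ_le le_rfl).trans 𝒯.negS_mul_negS.le) le_rfl
  obtain ⟨⟨k, hk⟩, ⟨l, hl⟩⟩ := exists_lower_eq M
  have h (n : ℕ) : 𝒯.negS • V ⊔ lower M (l - n) = ⊤ := by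
    induction n with
    | zero => simp [hl]
    | succ n ih =>
      refine step _ ?_
      rwa [Nat.cast_succ, sub_add_eq_sub_sub, sub_add_cancel]
  have hle : lower M (l - (l - k).toNat) ≤ lower M k ∨ l ≤ k := by
    by_cases hlk : l ≤ k
    · exact Or.inr hlk
    · left
      rw [Int.toNat_of_nonneg (by omega), sub_sub_cancel]
  rcases hle with hle | hle
  · have := h (l - k).toNat
    rwa [eq_bot_iff.2 (hle.trans hk.le), sup_bot_eq] at this
  · have hlk : lower M l ≤ lower M k := iSup₂_le fun i hi => gr_le_lower M (by omega)
    have := h 0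
    rwa [Nat.cast_zero, sub_zero, eq_bot_iff.2 (hlk.trans hk.le), sup_bot_eq] at this

/-- The dimension of `M / A⁻_{<0} M`. -/
def headDim (𝒯 : TriangularDecomposition 𝒜) (M : GrMod 𝒜) : ℕ := finrank K (M ⧸ rad 𝒯 M)

lemma headDim_add : headDim 𝒯 M + finrank K (rad 𝒯 M) = finrank K M :=
  Submodule.finrank_quotient_add_finrank _

/-- By Nakayama, $M$ is generated over $A^-$ by any complement of the radical. The reverse
inequality, tightness, is the substitute for freeness over $A^-$. -/
lemma finrank_le_mul_headDim : finrank K M ≤ finrank K 𝒯.negS * headDim 𝒯 M := by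
  obtain ⟨V, hV⟩ := exists_isCompl (rad 𝒯 M)
  have h1 := negS_smul_eq_top M (sup_comm _ V ▸ hV.sup_eq_top)
  have h2 := Submodule.finrank_add_eq_of_isCompl hV
  have h3 := headDim_add (𝒯 := 𝒯) M
  have h4 := finrank_smul_le 𝒯.negS V
  rw [h1, finrank_top] at h4
  rwa [show headDim 𝒯 M = finrank K V by omega]

end FiniteDimensional

end TriangularDecomposition

/-! ### The dimension of the proper standard modules -/

namespace TriangularDecomposition

open GrMod Module

variable {K : Type v} [Field K] {A : Type u} [Ring A] [Algebra K A] {𝒜 : ℤ → Submodule K A}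
  [GradedAlgebra 𝒜] {𝒯 : TriangularDecomposition 𝒜} [FiniteDimensional K A]

section Range

variable {M : GrMod 𝒯.gradT} {N : GrMod 𝒜} (j : M →ₗ[𝒯.T] N)

/-- The range of a `T`-linear map, as a subspace. -/
def rangeK : Submodule K N := LinearMap.range (j.restrictScalars K)

lemma finrank_rangeK_le : finrank K (rangeK j) ≤ finrank K M := LinearMap.finrank_range_le _

omit [FiniteDimensional K A] in
lemma finrank_rangeK (hj : Function.Injective j) : finrank K (rangeK j) = finrank K M :=
  LinearMap.finrank_range_of_inj (f := j.restrictScalars K) hj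

omit [FiniteDimensional K A] in
lemma span_range_eq (hb : ∀ i, 0 < i → ∀ b ∈ 𝒯.borel, b ∈ 𝒜 i → ∀ m, b • j m = 0) :
    (Submodule.span A (Set.range j)).restrictScalars K = 𝒯.negS • rangeK j := by
  refine span_eq_negS_smul N (S := rangeK j) (Submodule.smul_le.2 ?_) (posJ_smul_eq_bot N ?_)
  · rintro t ht _ ⟨m, rfl⟩
    exact ⟨(⟨t, ht⟩ : 𝒯.T) • m, j.map_smul _ m⟩
  · rintro i hi b hbb hbi _ ⟨m, rfl⟩
    exact hb i hi b hbb hbi m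

end Range

lemma negS_smul_rangeK_gen (M : GrMod 𝒯.gradT) : 𝒯.negS • rangeK (gen M) = ⊤ := by
  rw [← span_range_eq (gen M) fun i hi b hb hbi => smul_gen_eq_zero M hi hb hbi, span_range_gen]
  rfl

lemma finrank_properStandard_le (M : GrMod 𝒯.gradT) :
    finrank K (𝒯.properStandard M) ≤ finrank K 𝒯.negS * finrank K M := by
  have h := finrank_smul_le 𝒯.negS (rangeK (gen M))
  rw [negS_smul_rangeK_gen, finrank_top] at h
  exact h.trans (Nat.mul_le_mul le_rfl (finrank_rangeK_le _))

/-- Over a semisimple ring a simple module is isomorphic to a left ideal, and left ideals are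
generated by idempotents. The map `ψ` realises the weight as $Te$ inside $A$. -/
lemma exists_idempotent [IsSemisimpleRing 𝒯.T] (a : 𝒯.Weight) :
    ∃ e ∈ 𝒯.T, e * e = e ∧ ∃ ψ : a.rep →ₗ[𝒯.T] A, Function.Injective ψ ∧
      (∀ m, ψ m ∈ 𝒯.T ∧ ψ m * e = ψ m) ∧ ∃ x, ψ x = e := by
  obtain ⟨I, ⟨ε⟩⟩ := IsSemisimpleRing.exists_linearEquiv_ideal_of_isSimpleModule 𝒯.T a.rep
  obtain ⟨e, he, rfl⟩ := IsSemisimpleRing.ideal_eq_span_idempotent I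
  have he : e * e = e := he
  refine ⟨e, e.2, congrArg Subtype.val he, ⟨⟨fun m => ((ε m : 𝒯.T) : A), fun x y => ?_⟩,
    fun t x => ?_⟩, fun x y hxy => ε.injective (Subtype.ext (Subtype.ext hxy)), fun m => ⟨?_, ?_⟩,
    ε.symm ⟨e, Ideal.mem_span_singleton_self e⟩, ?_⟩
  · rw [map_add]; rfl
  · change ((ε (t • x) : 𝒯.T) : A) = _
    rw [map_smul]; rfl
  · exact (ε m : 𝒯.T).2
  · obtain ⟨t, ht⟩ := Ideal.mem_span_singleton'.1 (ε m).2
    change ((ε m : 𝒯.T) : A) * e = (ε m : 𝒯.T)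
    rw [← ht]
    exact congrArg Subtype.val (by rw [mul_assoc, he] : t * e * e = t * e)
  · change ((ε (ε.symm _) : 𝒯.T) : A) = e
    rw [LinearEquiv.apply_symm_apply]

section Idempotent

variable {e : A}

lemma finrank_mul_span_add_le (he : e * e = e) {U : Submodule K A}
    (hU : U * Submodule.span K {e} ≤ U) :
    finrank K ↥(U * Submodule.span K {e}) + finrank K ↥(U * Submodule.span K {1 - e}) ≤
      finrank K U := by
  have hdisj : Disjoint (U * Submodule.span K {e}) (U * Submodule.span K {1 - e}) := by
    rw [Submodule.disjoint_def]
    intro x hx hx'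
    obtain ⟨u, _, rfl⟩ := Submodule.mem_mul_span_singleton.1 hx
    obtain ⟨w, _, hw⟩ := Submodule.mem_mul_span_singleton.1 hx'
    rw [← he, ← mul_assoc, ← hw, mul_assoc, sub_mul, he, one_mul, sub_self, mul_zero]
  have h := Submodule.finrank_sup_add_finrank_inf_eq (U * Submodule.span K {e})
    (U * Submodule.span K {1 - e})
  rw [hdisj.eq_bot, finrank_bot, add_zero] at h
  rw [← h]
  refine Submodule.finrank_mono (sup_le hU fun x hx => ?_)
  obtain ⟨u, hu, rfl⟩ := Submodule.mem_mul_span_singleton.1 hx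
  rw [mul_sub, mul_one]
  exact sub_mem hu (hU (Submodule.mem_mul_span_singleton.2 ⟨u, hu, rfl⟩))

variable (𝒯)

lemma finrank_top_mul_span_le (e : A) :
    finrank K ↥((⊤ : Submodule K A) * Submodule.span K {e}) ≤
      finrank K 𝒯.negS * finrank K ↥(𝒯.borel * Submodule.span K {e}) := by
  rw [← 𝒯.negS_mul_borel, mul_assoc]
  exact finrank_smul_le 𝒯.negS (𝒯.borel * Submodule.span K {e})

/-- The upper bound $\dim A(1-e)\le n\dim B^+(1-e)$ and the bound $n\dim B^+\le\dim A$ force the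
lower bound for the complementary summand $Ae$. -/
lemma le_finrank_top_mul_span (heT : e ∈ 𝒯.T) (he : e * e = e) :
    finrank K 𝒯.negS * finrank K ↥(𝒯.borel * Submodule.span K {e}) ≤
      finrank K ↥((⊤ : Submodule K A) * Submodule.span K {e}) := by
  have h1 : finrank K ↥(𝒯.borel * Submodule.span K {e}) +
      finrank K ↥(𝒯.borel * Submodule.span K {1 - e}) ≤
      finrank K 𝒯.borel := by
    refine finrank_mul_span_add_le he ?_
    calc 𝒯.borel * Submodule.span K {e} ≤ 𝒯.borel * 𝒯.borel := by
          refine mul_le_mul' le_rfl ?_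
          rw [Submodule.span_singleton_le_iff_mem]
          exact 𝒯.T_le_borel heT
      _ = 𝒯.borel := 𝒯.borel_mul_borel
  have h2 := finrank_top_mul_span_le 𝒯 (1 - e)
  have h3 := 𝒯.finrank_negS_mul_finrank_borel_le
  have h4 : finrank K A ≤ finrank K ↥((⊤ : Submodule K A) * Submodule.span K {e}) +
      finrank K ↥((⊤ : Submodule K A) * Submodule.span K {1 - e}) := by
    rw [← finrank_top K A]
    refine (Submodule.finrank_mono ?_).trans
      (Submodule.finrank_add_le_finrank_add_finrank _ _)
    intro x _
    have hx : x = x * e + x * (1 - e) := by rw [← mul_add, add_sub_cancel, mul_one]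
    rw [hx]
    exact Submodule.add_mem_sup (Submodule.mem_mul_span_singleton.2 ⟨x, trivial, rfl⟩)
      (Submodule.mem_mul_span_singleton.2 ⟨x, trivial, rfl⟩)
  have h5 := Nat.mul_le_mul (le_refl (finrank K 𝒯.negS)) h1
  rw [mul_add] at h5
  omega

/-- $Te$ is in degree zero and $J^+e$ in positive degrees, so they meet trivially inside $B^+e$. -/
lemma finrank_T_mul_add_le (e : A) (he : e ∈ 𝒜 0) :
    finrank K ↥(Subalgebra.toSubmodule 𝒯.T * Submodule.span K {e}) +
      finrank K ↥(𝒯.posJ * Submodule.span K {e}) ≤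
      finrank K ↥(𝒯.borel * Submodule.span K {e}) := by
  have hdisj : Disjoint (Subalgebra.toSubmodule 𝒯.T * Submodule.span K {e})
      (𝒯.posJ * Submodule.span K {e}) := by
    rw [Submodule.disjoint_def]
    intro x hx hx'
    obtain ⟨t, ht, rfl⟩ := Submodule.mem_mul_span_singleton.1 hx
    have h0 : t * e ∈ 𝒜 0 := by
      have := SetLike.mul_mem_graded (𝒯.T_degree t ht) he
      rwa [add_zero] at this
    rw [← projComp_of_mem h0]
    have hle : 𝒯.posJ * Submodule.span K {e} ≤ LinearMap.ker (projComp 𝒜 0) := by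
      rw [posJ]
      simp only [Submodule.iSup_mul]
      refine iSup₂_le fun i hi y hy => ?_
      obtain ⟨b, hb, rfl⟩ := Submodule.mem_mul_span_singleton.1 hy
      have := SetLike.mul_mem_graded hb.2 he
      rw [add_zero] at this
      exact projComp_of_mem_ne this (by omega)
    exact hle hx'
  have h := Submodule.finrank_sup_add_finrank_inf_eq
    (Subalgebra.toSubmodule 𝒯.T * Submodule.span K {e})
    (𝒯.posJ * Submodule.span K {e})
  rw [hdisj.eq_bot, finrank_bot, add_zero, ← Submodule.sup_mul, ← borel_eq] at h
  exact h.ge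

end Idempotent

omit [FiniteDimensional K A] in
lemma range_eq_mul_span {a : 𝒯.Weight} {e : A} {ψ : a.rep →ₗ[𝒯.T] A}
    (hψ : ∀ m, ψ m ∈ 𝒯.T ∧ ψ m * e = ψ m) {x : a.rep} (hx : ψ x = e) :
    LinearMap.range (ψ.restrictScalars K) = Subalgebra.toSubmodule 𝒯.T * Submodule.span K {e} := by
  ext y
  rw [Submodule.mem_mul_span_singleton]
  constructor
  · rintro ⟨m, rfl⟩
    exact ⟨ψ m, (hψ m).1, (hψ m).2⟩
  · rintro ⟨t, ht, rfl⟩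
    exact ⟨(⟨t, ht⟩ : 𝒯.T) • x, by rw [LinearMap.restrictScalars_apply, map_smul, hx]; rfl⟩

/-- With $a\cong Te$, the image of $\Delta(a)$ in $A/AJ^+e$ contains that of $Ae$, of dimension at
least $\dim Ae-\dim AJ^+e$. Here $\dim Ae\ge n\dim B^+e\ge n(\dim a+\dim J^+e)$, and
$AJ^+e=A^-B^+J^+e\subseteq A^-J^+e$ has dimension at most $n\dim J^+e$. -/
lemma le_finrank_Δ [IsSemisimpleRing 𝒯.T] (a : 𝒯.Weight) :
    finrank K 𝒯.negS * finrank K a.rep ≤ finrank K (𝒯.Δ a) := by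
  obtain ⟨e, heT, he, ψ, hψi, hψ, x, hx⟩ := exists_idempotent a
  let X := regular 𝒜 a.deg
  let s : Set A := {y | ∃ i, 0 < i ∧ ∃ b ∈ 𝒯.borel, b ∈ 𝒜 i ∧ b * e = y}
  have he0 := 𝒯.T_degree e heT
  let W : Submodule A X := Submodule.span A s
  have hW : W.IsHomogeneous X.gr := by
    refine span_isHomogeneous 𝒜 X _ ?_
    rintro _ ⟨i, hi, b, hb, hbi, rfl⟩ n
    refine X.projComp_mem_of_mem_gr (Submodule.span A s) (j := i + a.deg) ?_
      (Submodule.subset_span ⟨i, hi, b, hb, hbi, rfl⟩) n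
    change b * e ∈ 𝒜 (i + a.deg - a.deg)
    have := SetLike.mul_mem_graded hbi he0
    rwa [add_sub_cancel_right, ← add_zero i]
  let q : A →ₗ[A] X.quotient W hW := (W.mkQ :)
  have hqker (y : A) (hy : y ∈ Submodule.span A s) : q y = 0 :=
    (Submodule.Quotient.mk_eq_zero _).2 hy
  obtain ⟨f, hf⟩ := exists_desc (M := a.rep) ((q.restrictScalars 𝒯.T) ∘ₗ ψ) (N := X.quotient W hW)
    (by
      intro i m hm
      by_cases hi : i = a.deg
      · refine ⟨ψ m, ?_, rfl⟩
        change ψ m ∈ 𝒜 (i - a.deg)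
        rw [hi, sub_self]
        exact 𝒯.T_degree _ (hψ m).1
      · rw [gr_rep_of_ne a hi, Submodule.mem_bot] at hm
        rw [hm, map_zero]
        exact zero_mem _)
    (by
      intro i hi b hb hbi m
      change b • q (ψ m) = 0
      -- Writing $\psi(m)=\psi(m)e$ exhibits $b\psi(m)$ as an element of $J^+e$.
      rw [← map_smul, smul_eq_mul, ← (hψ m).2, ← mul_assoc]
      refine hqker _ (Submodule.subset_span ⟨i, hi, b * ψ m, ?_, ?_, rfl⟩)
      · rw [← borel_mul_borel]
        exact Submodule.mul_mem_mul hb (𝒯.T_le_borel (hψ m).1)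
      · have := SetLike.mul_mem_graded hbi (𝒯.T_degree _ (hψ m).1)
        rwa [add_zero] at this)
  have h1 := 𝒯.le_finrank_top_mul_span heT he
  have h2 := 𝒯.finrank_T_mul_add_le e he0
  rw [← range_eq_mul_span hψ hx, LinearMap.finrank_range_of_inj (f := ψ.restrictScalars K) hψi]
    at h2
  have h3 : finrank K ↥((Submodule.span A s).restrictScalars K) ≤
      finrank K 𝒯.negS * finrank K ↥(𝒯.posJ * Submodule.span K {e}) := by
    refine (Submodule.finrank_mono ?_).trans
      (finrank_smul_le 𝒯.negS (𝒯.posJ * Submodule.span K {e}))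
    calc (Submodule.span A s).restrictScalars K
        ≤ (Submodule.span A
            ((𝒯.posJ * Submodule.span K {e} : Submodule K A) : Set A)).restrictScalars K := by
          refine Submodule.span_mono ?_
          rintro _ ⟨i, hi, b, hb, hbi, rfl⟩
          exact Submodule.mem_mul_span_singleton.2 ⟨b,
            Submodule.mem_iSup_of_mem i (Submodule.mem_iSup_of_mem hi ⟨hb, hbi⟩), rfl⟩
      _ = 𝒯.negS * (𝒯.borel * (𝒯.posJ * Submodule.span K {e})) := by
          rw [restrictScalars_span_eq_top_smul, ← 𝒯.negS_mul_borel, smul_eq_mul, mul_assoc]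
      _ ≤ 𝒯.negS * (𝒯.posJ * Submodule.span K {e}) := by
          refine mul_le_mul' le_rfl ?_
          rw [← mul_assoc]
          exact mul_le_mul' 𝒯.borel_mul_posJ le_rfl
  let g : ↥((⊤ : Submodule K A) * Submodule.span K {e}) →ₗ[K] X.quotient W hW :=
    (q.restrictScalars K).domRestrict _
  have h4 : finrank K (LinearMap.range g) ≤ finrank K (𝒯.Δ a) := by
    refine (Submodule.finrank_mono ?_).trans
      (LinearMap.finrank_range_le ((lin f).restrictScalars K : 𝒯.Δ a →ₗ[K] X.quotient W hW))
    rintro _ ⟨⟨y, hy⟩, rfl⟩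
    obtain ⟨b, _, rfl⟩ := Submodule.mem_mul_span_singleton.1 hy
    refine ⟨b • gen a.rep x, ?_⟩
    change lin f (b • gen a.rep x) = q (b * e)
    rw [map_smul, hf, ← smul_eq_mul, map_smul, LinearMap.comp_apply, hx]
    rfl
  have h5 : finrank K (LinearMap.ker g) ≤ finrank K ↥((Submodule.span A s).restrictScalars K) := by
    let ι : LinearMap.ker g →ₗ[K] ↥((Submodule.span A s).restrictScalars K) :=
      LinearMap.codRestrict _
        (((⊤ : Submodule K A) * Submodule.span K {e}).subtype ∘ₗ (LinearMap.ker g).subtype)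
        fun y => (Submodule.Quotient.mk_eq_zero _).1 y.2
    refine LinearMap.finrank_le_finrank_of_injective (f := ι) fun y z h => ?_
    have h' := congrArg Subtype.val h
    exact Subtype.ext (Subtype.ext h')
  have h6 := LinearMap.finrank_range_add_finrank_ker g
  have h7 := Nat.mul_le_mul (le_refl (finrank K 𝒯.negS)) h2
  rw [mul_add] at h7
  omega

end TriangularDecomposition

/-! ### Simple quotients and degree bounds -/

namespace GrMod

variable {K : Type v} [Field K] {A : Type u} [Ring A] [Algebra K A] {𝒜 : ℤ → Submodule K A}
  [FiniteDimensional K A]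

lemma exists_simple_quotient (M : GrMod 𝒜) [Nontrivial M] :
    ∃ (S : GrMod 𝒜) (g : M ⟶ S), Simple S ∧ Function.Surjective (lin g) := by
  obtain ⟨N, ⟨hN, hne⟩, hmax⟩ := wellFounded_gt.has_min
    {N : Submodule A M | N.IsHomogeneous M.gr ∧ N ≠ ⊤} ⟨⊥, fun i m hm => by
      rw [(Submodule.mem_bot A).1 hm, DirectSum.decompose_zero]; rfl, bot_ne_top⟩
  have hs := mkQ_surjective M N hN
  refine ⟨M.quotient N hN, M.mkQ N hN, simple_iff.2 ⟨?_, fun N' hN' hb => ?_⟩, hs⟩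
  · obtain ⟨x, hx⟩ : ∃ x, x ∉ N := by
      by_contra! h
      exact hne (eq_top_iff.2 fun x _ => h x)
    exact ⟨lin (M.mkQ N hN) x, 0, fun h0 => hx ((Submodule.Quotient.mk_eq_zero N).1 h0)⟩
  · by_contra hnt
    refine hmax (N'.comap (lin (M.mkQ N hN))) ⟨comap_isHomogeneous _ hN', fun ht => hnt ?_⟩ ?_
    · refine eq_top_iff.2 fun y _ => ?_
      obtain ⟨x, rfl⟩ := hs y
      have : x ∈ N'.comap (lin (M.mkQ N hN)) := ht ▸ trivial
      exact this
    · refine lt_of_le_of_ne (fun x hx => ?_) fun heq => hb (eq_bot_iff.2 fun y hy => ?_)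
      · have : lin (M.mkQ N hN) x = 0 := (Submodule.Quotient.mk_eq_zero N).2 hx
        rw [Submodule.mem_comap, this]
        exact zero_mem _
      · obtain ⟨x, rfl⟩ := hs y
        have hx : x ∈ N := heq ▸ (show x ∈ N'.comap (lin (M.mkQ N hN)) from hy)
        exact (Submodule.Quotient.mk_eq_zero N).2 hx

omit [FiniteDimensional K A] in
lemma gr_eq_bot_of_surjective {M N : GrMod 𝒜} {f : M ⟶ N} (hf : Function.Surjective (lin f))
    {i : ℤ} (h : M.gr i = ⊥) : N.gr i = ⊥ := by
  rw [eq_bot_iff]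
  intro y hy
  obtain ⟨x, hx, rfl⟩ := surjective_on_gr hf hy
  rw [h, Submodule.mem_bot] at hx
  rw [hx, map_zero]
  exact zero_mem _

omit [FiniteDimensional K A] in
lemma gr_eq_bot_of_injective {M N : GrMod 𝒜} {f : M ⟶ N} (hf : Function.Injective (lin f))
    {i : ℤ} (h : N.gr i = ⊥) : M.gr i = ⊥ := by
  rw [eq_bot_iff]
  intro x hx
  have := lin_mem f hx
  rw [h, Submodule.mem_bot] at this
  exact hf (this.trans (map_zero _).symm)

end GrMod

/-! ### Structure of $\Delta(\lambda)$ and classification of the simple modules -/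

namespace TriangularDecomposition

open GrMod Module

variable {K : Type v} [Field K] {A : Type u} [Ring A] [Algebra K A] {𝒜 : ℤ → Submodule K A}
  [GradedAlgebra 𝒜] {𝒯 : TriangularDecomposition 𝒜} [FiniteDimensional K A]

omit [GradedAlgebra 𝒜] [FiniteDimensional K A] in
lemma smul_eq_zero_of_gr {N : GrMod 𝒜} {d : ℤ} (htop : ∀ i, d < i → N.gr i = ⊥) {i : ℤ}
    (hi : 0 < i) {b : A} (hb : b ∈ 𝒜 i) {x : N} (hx : x ∈ N.gr d) : b • x = 0 := by
  have := N.smul_mem hb hx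
  rwa [htop _ (by omega), Submodule.mem_bot] at this

omit [FiniteDimensional K A] in
lemma lin_smul_T {M N : GrMod 𝒜} (f : M ⟶ N) (t : 𝒯.T) (x : M) : lin f (t • x) = t • lin f x :=
  (lin f).map_smul (t : A) x

/-- The canonical map from the weight `a` to `Δ a`. -/
def genΔ (a : 𝒯.Weight) : a.rep →ₗ[𝒯.T] 𝒯.Δ a := gen a.rep

lemma span_range_genΔ (a : 𝒯.Weight) : Submodule.span A (Set.range (genΔ a)) = ⊤ :=
  span_range_gen a.rep

lemma negS_smul_rangeK_genΔ (a : 𝒯.Weight) : 𝒯.negS • rangeK (genΔ a) = ⊤ :=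
  negS_smul_rangeK_gen a.rep

/-- Elements of positive degree kill the top component for degree reasons, so any copy of a weight
there extends to its proper standard module. -/
lemma exists_Δ_hom {N : GrMod 𝒜} {a : 𝒯.Weight} (htop : ∀ i, a.deg < i → N.gr i = ⊥)
    (j : a.rep →ₗ[𝒯.T] N) (hj : ∀ m, j m ∈ N.gr a.deg) :
    ∃ f : 𝒯.Δ a ⟶ N, ∀ m, lin f (genΔ a m) = j m := by
  refine exists_desc j (fun i m hm => ?_) fun i hi b _ hb m => smul_eq_zero_of_gr htop hi hb (hj m)
  by_cases h : i = a.deg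
  · rw [h]; exact hj m
  · rw [gr_rep_of_ne a h, Submodule.mem_bot] at hm
    rw [hm, map_zero]
    exact zero_mem _

lemma genΔ_mem_gr (a : 𝒯.Weight) (m : a.rep) : genΔ a m ∈ (𝒯.Δ a).gr a.deg :=
  gen_mem a.rep (mem_gr_rep a m)

lemma finrank_rep_pos (a : 𝒯.Weight) : 0 < finrank K a.rep :=
  have : Nontrivial a.rep := nontrivial_rep a
  finrank_pos

lemma finrank_negS_pos (a : 𝒯.Weight) : 0 < finrank K 𝒯.negS := by
  have : Nontrivial a.rep := nontrivial_rep a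
  have : Nontrivial 𝒯.T := Module.nontrivial 𝒯.T a.rep
  have : Nontrivial A := Subtype.val_injective (p := (· ∈ 𝒯.T)) |>.nontrivial
  exact finrank_pos (R := K) (M := 𝒯.neg)

lemma exists_eq_gen_add (a : 𝒯.Weight) (x : 𝒯.Δ a) :
    ∃ m, ∃ y ∈ lower (𝒯.Δ a) a.deg, x = genΔ a m + y := by
  have hx : x ∈ 𝒯.negS • rangeK (genΔ a) := by
    rw [negS_smul_rangeK_genΔ]; trivial
  have hle : rangeK (genΔ a) ≤ lower (𝒯.Δ a) (a.deg + 1) := by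
    rintro _ ⟨m, rfl⟩
    exact gr_le_lower (𝒯.Δ a) (lt_add_one _) (genΔ_mem_gr a m)
  rw [negS_eq, Submodule.sup_smul, Submodule.one_smul] at hx
  obtain ⟨_, ⟨m, rfl⟩, y, hy, rfl⟩ := Submodule.mem_sup.1 hx
  exact ⟨m, y, negJ_smul_lower (𝒯 := 𝒯) (𝒯.Δ a) _ (Submodule.smul_mono le_rfl hle hy), rfl⟩

lemma exists_gen_eq (a : 𝒯.Weight) {x : 𝒯.Δ a} (hx : x ∈ (𝒯.Δ a).gr a.deg) :
    ∃ m, genΔ a m = x := by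
  obtain ⟨m, y, hy, h⟩ := exists_eq_gen_add a x
  refine ⟨m, ?_⟩
  have := congrArg (projComp (𝒯.Δ a).gr a.deg) h
  rwa [map_add, projComp_of_mem hx, projComp_of_mem (genΔ_mem_gr a m),
    projComp_of_mem_lower le_rfl hy, add_zero, eq_comm] at this

lemma gr_Δ_eq_bot (a : 𝒯.Weight) {i : ℤ} (hi : a.deg < i) : (𝒯.Δ a).gr i = ⊥ := by
  rw [eq_bot_iff]
  intro x hx
  obtain ⟨m, y, hy, h⟩ := exists_eq_gen_add a x
  have := congrArg (projComp (𝒯.Δ a).gr i) h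
  rwa [map_add, projComp_of_mem hx, projComp_of_mem_ne (genΔ_mem_gr a m) hi.ne,
    projComp_of_mem_lower hi.le hy, add_zero] at this

lemma exists_smul_eq (a : 𝒯.Weight) {x : a.rep} (hx : x ≠ 0) (y : a.rep) :
    ∃ t : 𝒯.T, t • x = y :=
  IsSimpleModule.toSpanSingleton_surjective 𝒯.T hx y

variable [IsSemisimpleRing 𝒯.T]

lemma finrank_Δ (a : 𝒯.Weight) :
    finrank K (𝒯.Δ a) = finrank K 𝒯.negS * finrank K a.rep :=
  le_antisymm (finrank_properStandard_le a.rep) (le_finrank_Δ a)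

/-- The image of `genΔ a` generates $\Delta(a)$ over $A^-$, so a proper quotient of $a$ would be too
small for $\dim\Delta(a)=n\dim a$. -/
lemma genΔ_injective (a : 𝒯.Weight) : Function.Injective (genΔ a) := by
  have h1 := finrank_smul_le 𝒯.negS (rangeK (genΔ a))
  rw [negS_smul_rangeK_genΔ, finrank_top] at h1
  have h2 : finrank K a.rep ≤ finrank K (rangeK (genΔ a)) :=
    Nat.le_of_mul_le_mul_left ((le_finrank_Δ a).trans h1) (finrank_negS_pos a)
  have h3 := LinearMap.finrank_range_add_finrank_ker ((genΔ a).restrictScalars K)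
  have h4 : finrank K (LinearMap.ker ((genΔ a).restrictScalars K)) = 0 := by
    change finrank K a.rep ≤ finrank K (LinearMap.range ((genΔ a).restrictScalars K)) at h2
    omega
  have h5 := Submodule.finrank_eq_zero.1 h4
  exact (LinearMap.ker_eq_bot (f := (genΔ a).restrictScalars K)).1 h5

/-- The top component is a copy of the simple $T$-module $a$, so each nonzero vector yields all of
it, and it generates $\Delta(a)$. -/
lemma isLocalIn_Δ (a : 𝒯.Weight) : (𝒯.Δ a).IsLocalIn a.deg where
  ne_bot := by
    obtain ⟨x, hx⟩ := exists_ne (0 : a.rep)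
    refine (Submodule.ne_bot_iff _).2 ⟨genΔ a x, genΔ_mem_gr a x, fun h => hx ?_⟩
    exact genΔ_injective a (h.trans (map_zero _).symm)
  span_eq_top x hx hx0 := by
    obtain ⟨m, rfl⟩ := exists_gen_eq a hx
    have hm : m ≠ 0 := fun h => hx0 (h ▸ map_zero _)
    rw [eq_top_iff, ← span_range_genΔ, Submodule.span_le]
    rintro _ ⟨y, rfl⟩
    obtain ⟨t, rfl⟩ := exists_smul_eq a hm y
    rw [map_smul]
    exact Submodule.smul_mem _ (t : A) (Submodule.mem_span_singleton_self _)

/-- The projection `Δ a ⟶ L a`. -/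
def toL (a : 𝒯.Weight) : 𝒯.Δ a ⟶ 𝒯.L a := (𝒯.Δ a).toHead

omit [IsSemisimpleRing 𝒯.T] in
lemma toL_surjective (a : 𝒯.Weight) : Function.Surjective (lin (toL a)) :=
  toHead_surjective _

lemma simple_L (a : 𝒯.Weight) : Simple (𝒯.L a) := (isLocalIn_Δ a).simple_head

/-- The embedding of the weight `a` into `L a`. -/
def genL (a : 𝒯.Weight) : a.rep →ₗ[𝒯.T] 𝒯.L a :=
  (lin (toL a)).restrictScalars 𝒯.T ∘ₗ genΔ a

omit [IsSemisimpleRing 𝒯.T] in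
lemma genL_mem_gr (a : 𝒯.Weight) (m : a.rep) : genL a m ∈ (𝒯.L a).gr a.deg :=
  lin_mem (toL a) (genΔ_mem_gr a m)

omit [IsSemisimpleRing 𝒯.T] in
lemma exists_genL_eq (a : 𝒯.Weight) {x : 𝒯.L a} (hx : x ∈ (𝒯.L a).gr a.deg) :
    ∃ m, genL a m = x := by
  obtain ⟨y, hy, rfl⟩ := surjective_on_gr (toL_surjective a) hx
  obtain ⟨m, rfl⟩ := exists_gen_eq a hy
  exact ⟨m, rfl⟩

omit [IsSemisimpleRing 𝒯.T] in
lemma gr_L_eq_bot (a : 𝒯.Weight) {i : ℤ} (hi : a.deg < i) : (𝒯.L a).gr i = ⊥ :=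
  gr_eq_bot_of_surjective (toL_surjective a) (gr_Δ_eq_bot a hi)

lemma genL_injective (a : 𝒯.Weight) : Function.Injective (genL a) := by
  rw [← LinearMap.ker_eq_bot, eq_bot_iff]
  intro x hx
  have := (isLocalIn_Δ a).toHead_eq_zero (genΔ_mem_gr a x) hx
  exact genΔ_injective a (this.trans (map_zero _).symm)

omit [IsSemisimpleRing 𝒯.T] in
lemma span_range_genL (a : 𝒯.Weight) : Submodule.span A (Set.range (genL a)) = ⊤ := by
  have := congrArg (Submodule.map (lin (toL a))) (span_range_genΔ a)
  rw [Submodule.map_span, ← Set.range_comp, Submodule.map_top,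
    LinearMap.range_eq_top.2 (toL_surjective a)] at this
  exact this

lemma gr_L_ne_bot (a : 𝒯.Weight) : (𝒯.L a).gr a.deg ≠ ⊥ := by
  obtain ⟨x, hx⟩ := exists_ne (0 : a.rep)
  exact (Submodule.ne_bot_iff _).2 ⟨genL a x, genL_mem_gr a x, fun h => hx
    (genL_injective a (h.trans (map_zero _).symm))⟩

/-- An endomorphism acts on the top component, a copy of $a$, by a scalar because $T$ is split, and
that component generates $L(a)$. -/
lemma simple_end (a : 𝒯.Weight) (f : 𝒯.L a ⟶ 𝒯.L a) : ∃ c : K, f = c • 𝟙 (𝒯.L a) := by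
  have hex (m : a.rep) : ∃ m', genL a m' = lin f (genL a m) :=
    exists_genL_eq a (lin_mem f (genL_mem_gr a m))
  choose φ hφ using hex
  let φ' : a.rep →ₗ[𝒯.T] a.rep :=
    { toFun := φ
      map_add' x y := genL_injective a (by simp only [map_add, hφ])
      map_smul' t x := genL_injective a (by
        rw [hφ, (genL a).map_smul, lin_smul_T, RingHom.id_apply, (genL a).map_smul, hφ]) }
  obtain ⟨c, hc⟩ := 𝒯.T_split a.rep (isSimpleModule_rep a) φ'
  refine ⟨c, hom_ext fun x => ?_⟩
  have hx : x ∈ Submodule.span A (Set.range (genL a)) := span_range_genL a ▸ trivial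
  change lin f x = c • x
  induction hx using Submodule.span_induction with
  | mem x hx =>
    obtain ⟨m, rfl⟩ := hx
    rw [← hφ, ← (genL a).restrictScalars_apply K, ← (genL a).restrictScalars_apply K m, ← map_smul]
    exact congrArg _ (hc m)
  | zero => rw [map_zero, smul_zero]
  | add x y _ _ hx hy => rw [map_add, hx, hy, smul_add]
  | smul b x _ hx => rw [map_smul, hx, smul_comm]

/-- A weight inside the top component gives a nonzero map from a proper standard module, and this
identifies `S` with the head. -/
lemma exists_iso_L {S : GrMod 𝒜} (hS : Simple S) {d : ℤ} (hd : S.gr d ≠ ⊥)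
    (htop : ∀ i, d < i → S.gr i = ⊥) : ∃ a : 𝒯.Weight, a.deg = d ∧ Nonempty (S ≅ 𝒯.L a) := by
  obtain ⟨a, rfl, j, hj, hjm⟩ := exists_weight_map (𝒯 := 𝒯) S hd
  obtain ⟨f, hf⟩ := exists_Δ_hom htop j hjm
  refine ⟨a, rfl, ⟨((isLocalIn_Δ a).headIso hS f fun h0 => ?_).symm⟩⟩
  obtain ⟨x, hx⟩ := exists_ne (0 : a.rep)
  refine hx (hj ?_)
  rw [← hf, h0, map_zero]
  rfl

/-- The weight is recovered from $L(a)$ as the top component with its degree and $T$-action. -/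
lemma eq_of_iso_L {a b : 𝒯.Weight} (e : 𝒯.L a ≅ 𝒯.L b) : a = b := by
  have hle {a b : 𝒯.Weight} (e : 𝒯.L a ≅ 𝒯.L b) : a.deg ≤ b.deg := by
    by_contra! h
    refine gr_L_ne_bot a (gr_eq_bot_of_injective (bijective_of_isIso e.hom).1 (gr_L_eq_bot b h))
  have hd := le_antisymm (hle e) (hle e.symm)
  have hmem (m : a.rep) : lin e.hom (genL a m) ∈ (𝒯.L b).gr b.deg :=
    hd ▸ lin_mem e.hom (genL_mem_gr a m)
  choose φ hφ using fun m => exists_genL_eq b (hmem m)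
  let φ' : a.rep →ₗ[𝒯.T] b.rep :=
    { toFun := φ
      map_add' x y := genL_injective b (by simp only [map_add, hφ])
      map_smul' t x := genL_injective b (by
        rw [hφ, (genL a).map_smul, lin_smul_T, RingHom.id_apply, (genL b).map_smul, hφ]) }
  refine weight_ext hd (LinearEquiv.ofBijective φ' ⟨fun x y h => ?_, fun y => ?_⟩)
  · have h' : genL b (φ x) = genL b (φ y) := congrArg _ h
    rw [hφ, hφ] at h'
    exact genL_injective a ((bijective_of_isIso e.hom).1 h')
  · obtain ⟨x, hx, hxy⟩ := surjective_on_gr (bijective_of_isIso e.hom).2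
      (hd.symm ▸ genL_mem_gr b y)
    obtain ⟨m, rfl⟩ := exists_genL_eq a hx
    exact ⟨m, genL_injective b ((hφ m).trans hxy)⟩

lemma complete_L (S : GrMod 𝒜) (hS : Simple S) : ∃! a : 𝒯.Weight, Nonempty (S ≅ 𝒯.L a) := by
  have := (simple_iff.1 hS).1
  obtain ⟨d, hd, htop⟩ := exists_top_gr (𝒱 := S.gr)
  obtain ⟨a, _, ⟨e⟩⟩ := exists_iso_L (𝒯 := 𝒯) hS hd htop
  exact ⟨a, ⟨e⟩, fun b ⟨e'⟩ => eq_of_iso_L (e'.symm ≪≫ e)⟩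

/-- Split off simple quotients one by one; each is an $L(b)$ whose top degree `b.deg` must occur in
`M`. -/
lemma filteredBy_L (M : GrMod 𝒜) (d : ℤ) (h : ∀ i, d ≤ i → M.gr i = ⊥) :
    FilteredBy (fun Y => ∃ b : 𝒯.Weight, b.deg < d ∧ Nonempty (Y ≅ 𝒯.L b)) M := by
  induction hn : finrank K M using Nat.strong_induction_on generalizing M with
  | _ n ih =>
    rcases subsingleton_or_nontrivial M with hs | hs
    · exact .zero _ (isZero_iff.2 hs)
    · obtain ⟨S, g, hS, hg⟩ := exists_simple_quotient M
      have := (simple_iff.1 hS).1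
      obtain ⟨e, he, htop⟩ := exists_top_gr (𝒱 := S.gr)
      obtain ⟨b, rfl, hb⟩ := exists_iso_L (𝒯 := 𝒯) hS he htop
      refine .ext _ (shortExact_incl g hg) (ih _ ?_ _ (fun i hi => ?_) rfl) ⟨b, ?_, hb⟩
      · have h1 := LinearMap.finrank_range_add_finrank_ker ((lin g).restrictScalars K)
        have hr : LinearMap.range ((lin g).restrictScalars K) = ⊤ := LinearMap.range_eq_top.2 hg
        rw [hr, finrank_top] at h1
        have h2 : 0 < finrank K S := finrank_pos
        change finrank K (LinearMap.ker ((lin g).restrictScalars K)) < n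
        omega
      · exact gr_eq_bot_of_injective (incl_injective _ _ (ker_isHomogeneous g)) (h i hi)
      · by_contra! hle
        exact he (gr_eq_bot_of_surjective hg (h _ hle))

lemma standard_Δ (a : 𝒯.Weight) : ∃ (R : GrMod 𝒜) (i : R ⟶ 𝒯.Δ a) (p : 𝒯.Δ a ⟶ 𝒯.L a)
    (w : i ≫ p = 0), (ShortComplex.mk i p w).ShortExact ∧
      FilteredBy (fun Y => ∃ b, b < a ∧ Nonempty (Y ≅ 𝒯.L b)) R := by
  refine ⟨_, _, toL a, _, shortExact_incl (toL a) (toL_surjective a),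
    filteredBy_L _ a.deg fun i hi => ?_⟩
  -- In degree exactly `a.deg` the kernel vanishes because the top component embeds into the head;
  -- this makes the inequality of weights strict.
  rcases hi.eq_or_lt with rfl | hi
  · rw [eq_bot_iff]
    rintro ⟨x, hx⟩ hxd
    exact Subtype.ext ((isLocalIn_Δ a).toHead_eq_zero hxd hx)
  · exact gr_eq_bot_of_injective (incl_injective _ _ (ker_isHomogeneous (toL a)))
      (gr_Δ_eq_bot a hi)

end TriangularDecomposition

namespace GrMod

variable {K : Type v} [Field K] {A : Type u} [Ring A] [Algebra K A] {𝒜 : ℤ → Submodule K A}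
  [FiniteDimensional K A]

lemma filteredBy_of {S : GrMod 𝒜 → Prop} {X : GrMod 𝒜} (h : S X) : FilteredBy S X := by
  have hz : Subsingleton (zeroMod 𝒜) := inferInstanceAs (Subsingleton PUnit)
  refine .ext (ShortComplex.mk (0 : zeroMod 𝒜 ⟶ X) (𝟙 X) zero_comp) (shortExact_mk _ _ _
    (fun x y _ => Subsingleton.elim _ _) (fun x => ⟨x, rfl⟩) fun x hx => ?_)
    (.zero _ (isZero_iff.2 hz)) h
  exact ⟨0, hx.symm⟩

lemma finrank_range_add_finrank_ker {M N : GrMod 𝒜} (f : M ⟶ N) :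
    Module.finrank K (LinearMap.range (lin f)) + Module.finrank K (LinearMap.ker (lin f)) =
      Module.finrank K M :=
  LinearMap.finrank_range_add_finrank_ker ((lin f).restrictScalars K)

lemma finrank_add_finrank_ker {M N : GrMod 𝒜} {f : M ⟶ N} (hf : Function.Surjective (lin f)) :
    Module.finrank K N + Module.finrank K (LinearMap.ker (lin f)) = Module.finrank K M := by
  have hr : LinearMap.range ((lin f).restrictScalars K) = ⊤ := LinearMap.range_eq_top.2 hf
  have h := LinearMap.finrank_range_add_finrank_ker ((lin f).restrictScalars K)
  rwa [hr, finrank_top] at h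

end GrMod

/-! ### Tight modules and standard filtrations of projectives -/

namespace TriangularDecomposition

open GrMod Module

variable {K : Type v} [Field K] {A : Type u} [Ring A] [Algebra K A] {𝒜 : ℤ → Submodule K A}
  [GradedAlgebra 𝒜] {𝒯 : TriangularDecomposition 𝒜} [FiniteDimensional K A]

omit [FiniteDimensional K A] in
lemma map_rad_le {M N : GrMod 𝒜} (f : M ⟶ N) :
    (rad 𝒯 M).map ((lin f).restrictScalars K) ≤ rad 𝒯 N := by
  rw [rad, map_smul_submodule]
  exact Submodule.smul_mono le_rfl le_top

omit [FiniteDimensional K A] in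
lemma lin_mem_rad {M N : GrMod 𝒜} (f : M ⟶ N) {x : M} (hx : x ∈ rad 𝒯 M) :
    lin f x ∈ rad 𝒯 N :=
  map_rad_le f ⟨x, hx, rfl⟩

omit [FiniteDimensional K A] in
lemma rad_le_lower {M : GrMod 𝒜} {d : ℤ} (h : ∀ i, d < i → M.gr i = ⊥) :
    rad 𝒯 M ≤ lower M d := by
  have htop : lower M (d + 1) = ⊤ := by
    rw [eq_top_iff, ← (DirectSum.Decomposition.isInternal M.gr).submodule_iSup_eq_top]
    refine iSup_le fun i => ?_
    by_cases hi : d < i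
    · rw [h i hi]; exact bot_le
    · exact gr_le_lower M (by omega)
  rw [rad, ← htop]
  exact negJ_smul_lower M d

omit [FiniteDimensional K A] in
lemma sup_rad_eq_top {M : GrMod 𝒜} {V : Submodule K M} (h : 𝒯.negS • V = ⊤) :
    V ⊔ rad 𝒯 M = ⊤ := by
  rw [eq_top_iff, ← h, negS_eq, Submodule.sup_smul, Submodule.one_smul]
  exact sup_le_sup le_rfl (Submodule.smul_mono le_rfl le_top)

lemma headDim_le_of_sup_rad {M : GrMod 𝒜} {V : Submodule K M} (h : V ⊔ rad 𝒯 M = ⊤) :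
    headDim 𝒯 M ≤ finrank K V := by
  have h1 := Submodule.finrank_add_le_finrank_add_finrank V (rad 𝒯 M)
  rw [h, finrank_top] at h1
  have h2 := headDim_add (𝒯 := 𝒯) M
  omega

/-- The quotient $N/\operatorname{rad}N$ is an image of $M/(S+\operatorname{rad}M)$, and `S`
survives in $M/\operatorname{rad}M$. -/
lemma headDim_add_le_of_surjective {M N : GrMod 𝒜} {g : M ⟶ N}
    (hg : Function.Surjective (lin g)) {S : Submodule K M} (hS : S ≤
      LinearMap.ker ((lin g).restrictScalars K)) (hd : Disjoint S (rad 𝒯 M)) :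
    headDim 𝒯 N + finrank K S ≤ headDim 𝒯 M := by
  let φ : (M ⧸ (S ⊔ rad 𝒯 M)) →ₗ[K] N ⧸ rad 𝒯 N :=
    (S ⊔ rad 𝒯 M).liftQ ((rad 𝒯 N).mkQ ∘ₗ (lin g).restrictScalars K) <| sup_le
      (fun x hx => by
        have : lin g x = 0 := hS hx
        change (rad 𝒯 N).mkQ (lin g x) = 0
        rw [this, map_zero])
      (fun x hx => (Submodule.Quotient.mk_eq_zero _).2 (lin_mem_rad g hx))
  have hφ : Function.Surjective φ := by
    intro y
    obtain ⟨y, rfl⟩ := (rad 𝒯 N).mkQ_surjective y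
    obtain ⟨x, rfl⟩ := hg y
    exact ⟨Submodule.Quotient.mk x, rfl⟩
  have h1 := LinearMap.finrank_le_finrank_of_surjective hφ
  have h2 := Submodule.finrank_quotient_add_finrank (S ⊔ rad 𝒯 M)
  have h3 := Submodule.finrank_sup_add_finrank_inf_eq S (rad 𝒯 M)
  rw [hd.eq_bot, finrank_bot] at h3
  have h4 := headDim_add (𝒯 := 𝒯) M
  change headDim 𝒯 N ≤ _ at h1
  omega

variable [IsSemisimpleRing 𝒯.T]

/-- Let $f:\Delta(a)\to M$ extend a weight in the top component, and let $N$ be its cokernel. That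
component avoids the radical, so with $h(X)=\dim X/\operatorname{rad}X$ one gets $\dim N\le
n\,h(N)\le n(h(M)-\dim a)\le\dim M-\dim\Delta(a)\le\dim N$. Hence $f$ is injective and $N$ is tight,
and induction applies. Hypothesis `h₂` confines generators to degrees above `c`, hence also the
weights that occur. -/
lemma filteredBy_Δ (M : GrMod 𝒜) (c : ℤ) (h₁ : finrank K 𝒯.negS * headDim 𝒯 M ≤ finrank K M)
    (h₂ : ∀ i, i ≤ c → M.gr i ≤ rad 𝒯 M) :
    FilteredBy (fun Y => ∃ b : 𝒯.Weight, c < b.deg ∧ Nonempty (Y ≅ 𝒯.Δ b)) M := by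
  induction hn : finrank K M using Nat.strong_induction_on generalizing M with
  | _ n ih =>
    rcases subsingleton_or_nontrivial M with hs | hs
    · exact .zero _ (isZero_iff.2 hs)
    · obtain ⟨d, hd, htop⟩ := exists_top_gr (𝒱 := M.gr)
      obtain ⟨a, rfl, j, hj, hjm⟩ := exists_weight_map (𝒯 := 𝒯) M hd
      have hrad {x : M} (hx : x ∈ M.gr a.deg) (hx' : x ∈ rad 𝒯 M) : x = 0 := by
        rw [← projComp_of_mem hx]
        exact projComp_of_mem_lower le_rfl (rad_le_lower htop hx')
      have hca : c < a.deg := by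
        by_contra! hle
        exact hd (eq_bot_iff.2 fun x hx => hrad hx (h₂ _ hle hx))
      obtain ⟨f, hf⟩ := exists_Δ_hom htop j hjm
      let g := M.mkQ _ (range_isHomogeneous f)
      have hg : Function.Surjective (lin g) := mkQ_surjective _ _ _
      have hker : LinearMap.ker (lin g) = LinearMap.range (lin f) := ker_mkQ _ _ _
      have hS : rangeK j ≤ LinearMap.ker ((lin g).restrictScalars K) := by
        rintro _ ⟨m, rfl⟩
        have : j m ∈ LinearMap.ker (lin g) := by
          rw [hker, ← hf]
          exact ⟨_, rfl⟩
        exact this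
      have hdisj : Disjoint (rangeK j) (rad 𝒯 M) := by
        rw [Submodule.disjoint_def]
        rintro _ ⟨m, rfl⟩ hx
        exact hrad (hjm m) hx
      have e1 := headDim_add_le_of_surjective hg hS hdisj
      rw [finrank_rangeK j hj] at e1
      have e2 := finrank_add_finrank_ker hg
      rw [hker] at e2
      have e3 := finrank_le_mul_headDim (𝒯 := 𝒯) (M.quotient _ (range_isHomogeneous f))
      have e4 := Nat.mul_le_mul (le_refl (finrank K 𝒯.negS)) e1
      rw [mul_add] at e4
      have e5 := finrank_range_add_finrank_ker f
      rw [finrank_Δ] at e5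
      have e6 := Nat.mul_pos (finrank_negS_pos a) (finrank_rep_pos a)
      have e7 : finrank K (LinearMap.ker (lin f)) = 0 := by omega
      have hfi : Function.Injective (lin f) := by
        have h := Submodule.finrank_eq_zero.1
          (show finrank K (LinearMap.ker ((lin f).restrictScalars K)) = 0 from e7)
        exact (LinearMap.ker_eq_bot (f := (lin f).restrictScalars K)).1 h
      refine filteredBy_of_exact f g hfi hg hker.symm (filteredBy_of ⟨a, hca, ⟨Iso.refl _⟩⟩)
        (ih _ ?_ _ ?_ ?_ rfl)
      · omega
      · omega
      · rintro i hi _ ⟨x, hx, rfl⟩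
        exact lin_mem_rad g (h₂ i hi hx)

omit [IsSemisimpleRing 𝒯.T] in
-- For $X=P\oplus P'$ the generating space $V$ maps onto $P/\operatorname{rad}P\times
-- P'/\operatorname{rad}P'$. The general bound $\dim P'\le n\dim(P'/\operatorname{rad}P')$ then
-- leaves the reverse bound for $P$.
lemma mul_headDim_le_of_retract {P X : GrMod 𝒜} (r : Retract P X) {V : Submodule K X}
    (hV : V ⊔ rad 𝒯 X = ⊤) (hX : finrank K 𝒯.negS * finrank K V ≤ finrank K X) :
    finrank K 𝒯.negS * headDim 𝒯 P ≤ finrank K P := by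
  have hri (x : P) : lin r.r (lin r.i x) = x := LinearMap.congr_fun (congrArg lin r.retract) x
  have hr : Function.Surjective (lin r.r) := Function.RightInverse.surjective hri
  let P' := X.sub _ (ker_isHomogeneous r.r)
  let ι : P' ⟶ X := X.incl _ (ker_isHomogeneous r.r)
  have hι : Function.Injective (lin ι) := incl_injective _ _ _
  have hιr : LinearMap.range (lin ι) = LinearMap.ker (lin r.r) := range_incl _ _ _
  -- The complementary projection; its values lie in the kernel of the retraction, which is the
  -- other summand.
  let ρ : X ⟶ P' := liftOfInjective ι hι (𝟙 X - r.r ≫ r.i) (by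
    rw [hιr]
    rintro _ ⟨x, rfl⟩
    rw [LinearMap.mem_ker, lin_sub, LinearMap.sub_apply, map_sub]
    exact sub_eq_zero.2 (hri _).symm)
  have hρ (x : X) : lin ι (lin ρ x) = x - lin r.i (lin r.r x) := lin_liftOfInjective ..
  let φ : V →ₗ[K] (P ⧸ rad 𝒯 P) × (P' ⧸ rad 𝒯 P') :=
    (((rad 𝒯 P).mkQ ∘ₗ (lin r.r).restrictScalars K).prod
      ((rad 𝒯 P').mkQ ∘ₗ (lin ρ).restrictScalars K)) ∘ₗ V.subtype
  have hφ : Function.Surjective φ := by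
    rintro ⟨x, y⟩
    obtain ⟨x, rfl⟩ := (rad 𝒯 P).mkQ_surjective x
    obtain ⟨y, rfl⟩ := (rad 𝒯 P').mkQ_surjective y
    have hy : lin r.r (lin ι y) = 0 := by
      have : lin ι y ∈ LinearMap.range (lin ι) := ⟨y, rfl⟩
      rwa [hιr] at this
    obtain ⟨v, hv, w, hw, hvw⟩ := Submodule.mem_sup.1
      (show lin r.i x + lin ι y ∈ V ⊔ rad 𝒯 X by rw [hV]; trivial)
    have h1 : lin r.r v + lin r.r w = x := by
      rw [← map_add, hvw, map_add, hri, hy, add_zero]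
    have h2 : lin ρ v + lin ρ w = y := by
      apply hι
      rw [← map_add, hvw, hρ, map_add, hri, hy, add_zero, add_sub_cancel_left]
    refine ⟨⟨v, hv⟩, Prod.ext ?_ ?_⟩
    · change (rad 𝒯 P).mkQ (lin r.r v) = (rad 𝒯 P).mkQ x
      rw [← h1, map_add, show (rad 𝒯 P).mkQ (lin r.r w) = 0 from
        (Submodule.Quotient.mk_eq_zero _).2 (lin_mem_rad r.r hw), add_zero]
    · change (rad 𝒯 P').mkQ (lin ρ v) = (rad 𝒯 P').mkQ y
      rw [← h2, map_add, show (rad 𝒯 P').mkQ (lin ρ w) = 0 from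
        (Submodule.Quotient.mk_eq_zero _).2 (lin_mem_rad ρ hw), add_zero]
  have e1 := LinearMap.finrank_le_finrank_of_surjective hφ
  rw [Module.finrank_prod] at e1
  have e2 : finrank K P + finrank K P' = finrank K X := finrank_add_finrank_ker hr
  have e3 := finrank_le_mul_headDim (𝒯 := 𝒯) P'
  have e4 := Nat.mul_le_mul (le_refl (finrank K 𝒯.negS)) e1
  rw [mul_add] at e4
  change _ * headDim 𝒯 P + _ * headDim 𝒯 P' ≤ _ at e4
  omega

/-- `A e` is a direct summand of the regular module. -/
def retractLeftIdeal (d : ℤ) {e : A} (he : e ∈ 𝒜 0) (hee : e * e = e) :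
    Retract (leftIdeal d he) (regular 𝒜 d) where
  i := incl _ _ _
  r := ofLin (M := regular 𝒜 d) (LinearMap.toSpanSingleton A (leftIdeal d he) (leftIdealGen d he))
    fun i x hx => by
      have := (leftIdeal d he).smul_mem (i := i - d) (j := d) (a := x) hx (leftIdealGen_mem d he)
      rwa [sub_add_cancel] at this
  retract := hom_ext fun (x : Submodule.span A {e}) => by
    refine Subtype.ext ?_
    obtain ⟨a, ha⟩ := Submodule.mem_span_singleton.1 x.2
    change (x : A) * e = (x : A)
    rw [← ha, smul_eq_mul, mul_assoc, hee]

omit [IsSemisimpleRing 𝒯.T] in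
lemma mul_headDim_le_of_retract_leftIdeal {P : GrMod 𝒜} {d : ℤ} {e : A} (he : e ∈ 𝒜 0)
    (hee : e * e = e) (r : Retract P (leftIdeal d he)) :
    finrank K 𝒯.negS * headDim 𝒯 P ≤ finrank K P :=
  mul_headDim_le_of_retract (X := regular 𝒜 d) (V := (𝒯.borel :))
    (r.trans (retractLeftIdeal d he hee))
    (sup_rad_eq_top (M := regular 𝒜 d) 𝒯.negS_mul_borel) 𝒯.finrank_negS_mul_finrank_borel_le

omit [IsSemisimpleRing 𝒯.T] in
-- Modulo the radical $P=A^-B^+p$ reduces to $B^+p=Tp+J^+p$. The second part has degree above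
-- `a.deg`, and $Tp=Tep$ is an image of the weight, so its dimension is at most $\dim a$.
lemma exists_sup_rad_sup_upper_eq_top {P : GrMod 𝒜} {a : 𝒯.Weight} {e : A}
    {ψ : a.rep →ₗ[𝒯.T] A} (hψ : ∃ x, ψ x = e) {p : P} (hp : p ∈ P.gr a.deg)
    (hspan : Submodule.span A {p} = ⊤) (hep : e • p = p) :
    ∃ C : Submodule K P, finrank K C ≤ finrank K a.rep ∧
      C ⊔ (rad 𝒯 P ⊔ upper P a.deg) = ⊤ := by
  obtain ⟨x, hx⟩ := hψ
  let φ : a.rep →ₗ[K] P :=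
    (LinearMap.toSpanSingleton A P p).restrictScalars K ∘ₗ ψ.restrictScalars K
  refine ⟨LinearMap.range φ, LinearMap.finrank_range_le φ, ?_⟩
  have htop : (⊤ : Submodule K A) • Submodule.span K {p} = ⊤ := by
    rw [eq_top_iff]
    intro y _
    obtain ⟨b, rfl⟩ := Submodule.mem_span_singleton.1 (hspan ▸ trivial : y ∈ Submodule.span A {p})
    exact Submodule.smul_mem_smul trivial (Submodule.mem_span_singleton_self p)
  rw [← 𝒯.negS_mul_borel, ← smul_eq_mul, Submodule.smul_assoc] at htop
  rw [eq_top_iff, ← sup_rad_eq_top htop, borel_eq, Submodule.sup_smul]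
  refine sup_le (sup_le ?_ ?_) (le_sup_of_le_right le_sup_left)
  · refine le_sup_of_le_left (Submodule.smul_le.2 fun t ht y hy => ?_)
    obtain ⟨k, rfl⟩ := Submodule.mem_span_singleton.1 hy
    rw [smul_comm]
    refine Submodule.smul_mem _ k ⟨(⟨t, ht⟩ : 𝒯.T) • x, ?_⟩
    change ψ ((⟨t, ht⟩ : 𝒯.T) • x) • p = t • p
    rw [ψ.map_smul, hx]
    change (t * e) • p = t • p
    rw [mul_smul, hep]
  · refine le_sup_of_le_right (le_sup_of_le_right ?_)
    rw [posJ]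
    simp only [Submodule.iSup_smul]
    refine iSup₂_le fun i hi => Submodule.smul_le.2 fun b hb y hy => ?_
    obtain ⟨k, rfl⟩ := Submodule.mem_span_singleton.1 hy
    exact gr_le_upper P (i := i + a.deg) (by omega)
      (P.smul_mem hb.2 ((P.gr a.deg).smul_mem k hp))

/-- Choose generators $V\oplus C$ of $P$ modulo the radical, with $V$ in degrees above `a.deg` and
$\dim C\le\dim a$. Then $A^-V\subseteq\ker p$ for degree reasons, and $\dim A^-C\le n\dim
a=\dim\Delta(a)$ forces equality. So the kernel is generated over $A^-$ by $V$, and tightness of $P$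
passes to it. -/
lemma filteredBy_ker {P : GrMod 𝒜} {a : 𝒯.Weight} (p : P ⟶ 𝒯.Δ a)
    (hp : Function.Surjective (lin p))
    (h₁ : finrank K 𝒯.negS * headDim 𝒯 P ≤ finrank K P)
    (h₂ : ∃ C : Submodule K P, finrank K C ≤ finrank K a.rep ∧
      C ⊔ (rad 𝒯 P ⊔ upper P a.deg) = ⊤) :
    FilteredBy (fun Y => ∃ b : 𝒯.Weight, a.deg < b.deg ∧ Nonempty (Y ≅ 𝒯.Δ b))
      (P.sub _ (ker_isHomogeneous p)) := by
  obtain ⟨C₀, hC₀, hC₀top⟩ := h₂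
  obtain ⟨C, hC⟩ := exists_isCompl (rad 𝒯 P ⊔ upper P a.deg)
  obtain ⟨V₀, hV₀⟩ := exists_isCompl (rad 𝒯 P ⊓ upper P a.deg)
  -- By the modular law this is a complement of $\operatorname{rad}P\cap P_{>\deg a}$ inside
  -- $P_{>\deg a}$: generators of high degree, chosen independent of the radical.
  let V := V₀ ⊓ upper P a.deg
  have hVle : V ≤ upper P a.deg := inf_le_right
  have hVdisj : V ⊓ rad 𝒯 P = ⊥ := by
    rw [eq_bot_iff, ← hV₀.inf_eq_bot]
    exact fun x hx => ⟨⟨hx.2, hx.1.2⟩, hx.1.1⟩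
  have hVsup : V ⊔ rad 𝒯 P = rad 𝒯 P ⊔ upper P a.deg := by
    have h : (rad 𝒯 P ⊓ upper P a.deg ⊔ V₀) ⊓ upper P a.deg =
        (rad 𝒯 P ⊓ upper P a.deg) ⊔ V := sup_inf_assoc_of_le _ inf_le_right
    rw [hV₀.sup_eq_top, top_inf_eq] at h
    refine le_antisymm (sup_le (hVle.trans le_sup_right) le_sup_left) (sup_le le_sup_right ?_)
    rw [h]
    exact sup_le (inf_le_left.trans le_sup_right) le_sup_left
  have e1 := Submodule.finrank_sup_add_finrank_inf_eq V (rad 𝒯 P)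
  rw [hVsup, hVdisj, finrank_bot, add_zero] at e1
  have e2 := Submodule.finrank_add_eq_of_isCompl hC
  have e3 := Submodule.finrank_add_le_finrank_add_finrank C₀ (rad 𝒯 P ⊔ upper P a.deg)
  rw [hC₀top, finrank_top] at e3
  have e4 := headDim_add (𝒯 := 𝒯) P
  have htop : 𝒯.negS • (V ⊔ C) = ⊤ := negS_smul_eq_top P <| by
    rw [sup_right_comm, hVsup, hC.sup_eq_top]
  rw [Submodule.smul_sup] at htop
  have e5 := Submodule.finrank_add_le_finrank_add_finrank (𝒯.negS • V) (𝒯.negS • C)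
  rw [htop, finrank_top] at e5
  have e6 := finrank_smul_le 𝒯.negS C
  have e7 : finrank K 𝒯.negS * finrank K C ≤ finrank K 𝒯.negS * finrank K a.rep :=
    Nat.mul_le_mul le_rfl (by omega)
  have e8 := finrank_add_finrank_ker hp
  rw [finrank_Δ] at e8
  have hVker : V ≤ LinearMap.ker ((lin p).restrictScalars K) :=
    hVle.trans <| iSup₂_le fun i hi x hx => by
      have := lin_mem p hx
      rwa [gr_Δ_eq_bot a hi, Submodule.mem_bot] at this
  have hle : 𝒯.negS • V ≤ LinearMap.ker ((lin p).restrictScalars K) :=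
    Submodule.smul_le.2 fun b _ x hx => Submodule.smul_mem (LinearMap.ker (lin p)) b (hVker hx)
  change _ + finrank K (LinearMap.ker ((lin p).restrictScalars K)) = _ at e8
  have hker : 𝒯.negS • V = LinearMap.ker ((lin p).restrictScalars K) :=
    Submodule.eq_of_le_of_finrank_le hle (by omega)
  have e9 : finrank K 𝒯.negS * headDim 𝒯 P =
      finrank K 𝒯.negS * finrank K V + finrank K 𝒯.negS * finrank K C := by
    rw [← mul_add]; congr 1; omega
  let R := P.sub _ (ker_isHomogeneous p)
  let ι : R ⟶ P := P.incl _ (ker_isHomogeneous p)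
  have hι : Function.Injective (lin ι) := incl_injective _ _ _
  let V' : Submodule K R := V.comap ((lin ι).restrictScalars K)
  have hrange : LinearMap.range ((lin ι).restrictScalars K) =
      LinearMap.ker ((lin p).restrictScalars K) :=
    congrArg (Submodule.restrictScalars K) (range_incl P _ (ker_isHomogeneous p))
  have hV'map : V'.map ((lin ι).restrictScalars K) = V := by
    rw [Submodule.map_comap_eq, hrange]
    exact inf_eq_right.2 hVker
  have hV'top : 𝒯.negS • V' = ⊤ := by
    apply Submodule.map_injective_of_injective (f := (lin ι).restrictScalars K) hι
    rw [map_smul_submodule, hV'map, hker, Submodule.map_top, hrange]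
  have hsup := sup_rad_eq_top hV'top
  have hV'fin : finrank K V' = finrank K V := by
    rw [← hV'map]
    exact LinearEquiv.finrank_eq
      (Submodule.equivMapOfInjective ((lin ι).restrictScalars K) hι V')
  refine filteredBy_Δ R a.deg ?_ fun i hi x hx => ?_
  · have e10 := Nat.mul_le_mul (le_refl (finrank K 𝒯.negS)) (headDim_le_of_sup_rad hsup)
    have e11 : finrank K R = finrank K (LinearMap.ker ((lin p).restrictScalars K)) := rfl
    rw [hV'fin] at e10
    rw [hker] at e5
    omega
  -- The generator part has no component in degree `i`, so a homogeneous `x` of that degree is the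
  -- degree-`i` component of the radical part.
  · obtain ⟨v, hv, w, hw, hvw⟩ := Submodule.mem_sup.1 (hsup ▸ trivial : x ∈ V' ⊔ rad 𝒯 R)
    have hv0 : projComp R.gr i v = 0 := by
      apply hι
      rw [lin_projComp, map_zero]
      exact projComp_of_mem_upper hi (hVle hv)
    rw [← projComp_of_mem hx, ← hvw, map_add, hv0, zero_add]
    exact projComp_mem_rad R hw i

/-- The module $Ae$, with $e$ in degree `a.deg`, is projective and maps onto $L(a)$, so a projective
cover is a direct summand of it. Tightness and generation by the image of $e$ are inherited from
$Ae$, as the kernel argument requires. -/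
lemma exists_projective_filtration (a : 𝒯.Weight) :
    ∃ (P : GrMod 𝒜) (π : P ⟶ 𝒯.L a), IsProjectiveCover π ∧
      ∃ (N : GrMod 𝒜) (i : N ⟶ P) (p : P ⟶ 𝒯.Δ a) (w : i ≫ p = 0),
        (ShortComplex.mk i p w).ShortExact ∧
          FilteredBy (fun Y => ∃ b, a < b ∧ Nonempty (Y ≅ 𝒯.Δ b)) N := by
  obtain ⟨e, heT, hee, ψ, hψi, hψ, x, hx⟩ := exists_idempotent a
  have he := 𝒯.T_degree e heT
  let Q := leftIdeal (𝒜 := 𝒜) a.deg he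
  have hQ : Projective Q := projective_leftIdeal a.deg he hee
  have hx0 : (⟨e, heT⟩ : 𝒯.T) • x = x := hψi (by
    rw [ψ.map_smul, hx]
    exact hee)
  have hxne : x ≠ 0 := by
    rintro rfl
    have he0 : e = 0 := hx.symm.trans (map_zero ψ)
    obtain ⟨y, hy⟩ := exists_ne (0 : a.rep)
    refine hy (hψi ?_)
    rw [map_zero, ← (hψ y).2, he0, mul_zero]
  let q₀ : Q ⟶ 𝒯.L a := ofLin (M := Q)
    (LinearMap.toSpanSingleton A (𝒯.L a) (genL a x) ∘ₗ (Submodule.span A {e}).subtype)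
    fun i (y : Submodule.span A {e}) hy => by
      have := (𝒯.L a).smul_mem (i := i - a.deg) (j := a.deg) (a := y) hy (genL_mem_gr a x)
      rwa [sub_add_cancel] at this
  have hq₀gen : lin q₀ (leftIdealGen a.deg he) = genL a x := by
    change (⟨e, heT⟩ : 𝒯.T) • genL a x = genL a x
    rw [← map_smul, hx0]
  have hLne : (𝒯.L a).gr a.deg ≠ ⊥ := gr_L_ne_bot a
  have hgenne : genL a x ≠ 0 := fun h => hxne (genL_injective a (h.trans (map_zero _).symm))
  have hq₀s : Function.Surjective (lin q₀) := by
    rw [← LinearMap.range_eq_top]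
    refine (simple_iff.1 (simple_L a)).2 _ (range_isHomogeneous q₀) fun hb => hgenne ?_
    have : genL a x ∈ LinearMap.range (lin q₀) := ⟨_, hq₀gen⟩
    rwa [hb] at this
  have := epi_of_surjective q₀ hq₀s
  obtain ⟨P, π, hπ, ⟨r⟩⟩ := exists_projectiveCover q₀
  have hP := hπ.projective
  have := hπ.epi
  have hπs := surjective_of_epi π
  have := epi_of_surjective (toL a) (toL_surjective a)
  let p : P ⟶ 𝒯.Δ a := Projective.factorThru π (toL a)
  have hp : p ≫ toL a = π := Projective.factorThru_comp _ _
  -- A lift of $\pi$ to $\Delta(a)$ does not vanish on the head, and a proper graded submodule of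
  -- $\Delta(a)$ would.
  have hps : Function.Surjective (lin p) := by
    refine (isLocalIn_Δ a).surjective_of_toHead_ne_zero p fun h0 => ?_
    have hπ0 : π = 0 := hp.symm.trans h0
    obtain ⟨y, hy⟩ := hπs (genL a x)
    rw [hπ0] at hy
    exact hgenne hy.symm
  refine ⟨P, π, hπ, _, _, p, _, shortExact_incl p hps, filteredBy_ker p hps
    (mul_headDim_le_of_retract_leftIdeal he hee r)
    (exists_sup_rad_sup_upper_eq_top ⟨x, hx⟩ (p := lin r.r (leftIdealGen a.deg he))
      (lin_mem r.r (leftIdealGen_mem a.deg he)) ?_ ?_)⟩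
  · rw [eq_top_iff]
    intro y _
    have hy : lin r.r (lin r.i y) = y := LinearMap.congr_fun (congrArg lin r.retract) y
    rw [← hy]
    generalize lin r.i y = z
    obtain ⟨b, hb⟩ := Submodule.mem_span_singleton.1 (z : Submodule.span A {e}).2
    have hz : z = b • leftIdealGen a.deg he := Subtype.ext hb.symm
    rw [hz, map_smul]
    exact Submodule.smul_mem _ _ (Submodule.mem_span_singleton_self _)
  · rw [← map_smul]
    congr 1
    exact Subtype.ext hee

end TriangularDecomposition

end HWC

end

theorem mainTheorem2 {K : Type v} [Field K] {A : Type u} [Ring A] [Algebra K A]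
    [FiniteDimensional K A] (𝒜 : ℤ → Submodule K A) [GradedAlgebra 𝒜]
    (𝒯 : HWC.TriangularDecomposition 𝒜) (hT : IsSemisimpleRing 𝒯.T) :
    HWC.IsHighestWeightCategory K 𝒯.L 𝒯.Δ where
  abelian := ⟨inferInstance, rfl⟩
  finite_length := HWC.GrMod.finite_length
  hom_finite := HWC.GrMod.hom_finite
  enough_projectives := inferInstance
  interval_finite := HWC.TriangularDecomposition.finite_Icc
  simple := HWC.TriangularDecomposition.simple_L
  complete := HWC.TriangularDecomposition.complete_L
  simple_end := HWC.TriangularDecomposition.simple_end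
  standard := HWC.TriangularDecomposition.standard_Δ
  projective_filtration := HWC.TriangularDecomposition.exists_projective_filtration
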